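/- **Setting.** Let $T>1$. A finite scenario tree has stages $1,\dots,T$, with $\Omega_t$ the set of nodes of stage $t$ and $\Omega_1$ a single root; every node $\omega_t$ with $t>1$ has a unique parent $a(\omega_t)\in\Omega_{t-1}$, and every node $\omega_t$ with $t<T$ has a non-empty set $\mathcal C(\omega_t)$ of children. A leaf $\omega_T\in\Omega_T$ is called a scenario path, and $\Pi_t(\omega_T)$ is the stage-$t$ node through which it passes. At every node $\omega_t$ a cost $g_t(\cdot,\omega_t):\mathbb R^{n_t}\to\mathbb R$ is given, a maximum of finitely many affine functions, together with a feasible set $\mathcal X_t(x_{[t-1]},\omega_t)\subset\mathbb R^{n_t}$, described by finitely many linear inequalities in $(x_1,\dots,x_t)$, and non-empty and compact whenever the decision history $x_{[t-1]}=(x_1,\dots,x_{t-1})$ is feasible. For $t<T$ let $q(\cdot\mid\omega_t)$ be a probability vector on $\mathcal C(\omega_t)$, let $\gamma(\omega_t)\in[0,1]$, and let $$\mathcal P(\omega_t)=\Big\{p \text{ probability vector on } \mathcal C(\omega_t):\ \tfrac12\sum_{c\in\mathcal C(\omega_t)}|p(c)-q(c\mid\omega_t)|\le\gamma(\omega_t)\Big\}.$$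 The cost-to-go functions of the multistage distributionally robust problem (T-DRO-V) are $$Q_t(x_{[t-1]},\omega_t)=\min_{x_t\in\mathcal X_t(x_{[t-1]},\omega_t)}\Big\{g_t(x_t,\omega_t)+\max_{p\in\mathcal P(\omega_t)}\sum_{c\in\mathcal C(\omega_t)}p(c)\,Q_{t+1}(x_{[t]},c)\Big\},$$ where for $t=T$ the maximum is replaced by $0$; $Q_1$ is the optimal value. Let $x^*$ be an optimal policy satisfying these equations, that is, at every node $x^*_t$ is feasible and attains the minimum given the history $x^*_{[t-1]}$. **Effective paths.** For a scenario path $\omega'_T$, the assessment problem is obtained from T-DRO-V by replacing $\mathcal P(a(\omega'_T))$ with $\{p\in\mathcal P(a(\omega'_T)): p(\omega'_T)=0\}$; it is well defined if this set is non-empty, and $Q_1^{A}$ denotes its optimal value. The path $\omega'_T$ is *effective* if its assessment problem is not well defined (convention) or if $Q_1^{A}<Q_1$; otherwise it is *ineffective*. **Conditionally effective realizations.** Let $t<T$, $\omega_{t+1}\in\mathcal C(\omega_t)$, and let $Q_t^{CA}$ be the minimum obtained by replacing $\mathcal P(\omega_t)$ with $\{p\in\mathcal P(\omega_t):p(\omega_{t+1})=0\}$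 in the formula for $Q_t(x^*_{[t-1]},\omega_t)$, with $Q_{t+1}$ unchanged. The realization $\omega_{t+1}$ is *conditionally effective* if that set is empty or if $Q_t^{CA}<Q_t(x^*_{[t-1]},\omega_t)$; otherwise it is *conditionally ineffective*. **Identification.** Fix $\omega_t$ with $t<T$, and write $q,\gamma$ for $q(\cdot\mid\omega_t),\gamma(\omega_t)$. For $c\in\mathcal C(\omega_t)$ put $h(c)=g_t(x^*_t,\omega_t)+Q_{t+1}(x^*_{[t]},c)$. Let $\mathrm{VaR}=\inf\{\eta\in\mathbb R:\sum_{h(c)\le\eta}q(c)\ge\gamma\}$ (so $\mathrm{VaR}=-\infty$ if $\gamma=0$), and $$C_1=\{h<\mathrm{VaR}\},\quad C_2=\{h=\mathrm{VaR}\},\quad C_3=\{\mathrm{VaR}<h<\sup h\},\quad C_4=\{h=\sup h\}.$$ A child $c$ of $\omega_t$ is *identifiably conditionally effective* if at least one of the following holds: $q(c)>\gamma$; $\gamma>0$ and $C_4=\{c\}$; $c\in(C_3\cup C_4)\setminus C_2$ and $q(c)>0$; $c\in C_2$ and $q(C_1)+q(c)>\gamma$. It is *identifiably conditionally ineffective*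 if at least one of the following holds: $c\in C_1$; $q(c)=0$ and ($c\notin C_4$ or $\gamma=0$); $c\in C_2\setminus C_4$ and $q(C_1)+q(C_2)=\gamma$. (A realization may be neither.) **Theorem.** Let $\omega'_T\in\Omega_T$ be a scenario path. 0. For every $t=2,\dots,T$: if $\Pi_t(\omega'_T)$ is identifiably conditionally effective (ineffective), then it is conditionally effective (ineffective). 1. If $\Pi_t(\omega'_T)$ is identifiably conditionally effective for all $t=2,\dots,T$, then $\omega'_T$ is effective. 2. If the assessment problem of $\omega'_T$ is well defined and $\Pi_t(\omega'_T)$ is identifiably conditionally ineffective for some $t\in\{2,\dots,T\}$, then $\omega'_T$ is ineffective. 3. Consequently, if the assessment problem of $\omega'_T$ is well defined and each $\Pi_t(\omega'_T)$, $t=2,\dots,T$, is identified (as conditionally effective or as conditionally ineffective), then $\omega'_T$ is effective if and only if $\Pi_t(\omega'_T)$ is identifiably conditionally effective for all $t=2,\dots,T$. -/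

import Mathlib

open scoped Matrix

noncomputable section

namespace MultistageDRO

/-! ### Scenario trees -/

/-- A finite scenario tree with stages `1, …, T`. A node `ν` of stage `t` stands for a realization
of the history of the process up to stage `t`; every node other than the root has a unique
immediate ancestor `parent ν`, one stage earlier, and every node before the last stage has a
child. -/
structure ScenarioTree (T : ℕ) (N : Type*) where
  root : N
  stage : N → ℕ
  parent : N → N
  stage_root : stage root = 1
  parent_root : parent root = root
  stage_parent : ∀ c, c ≠ root → stage c = stage (parent c) + 1
  stage_le : ∀ ν, stage ν ≤ T
  exists_child : ∀ ν, stage ν < T → ∃ c, c ≠ root ∧ parent c = ν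

namespace ScenarioTree

variable {T : ℕ} {N : Type*} (tree : ScenarioTree T N)

/-- The set `C(ν)` of immediate children of a node. -/
def children [Fintype N] [DecidableEq N] (ν : N) : Finset N :=
  {c | c ≠ tree.root ∧ tree.parent c = ν}

/-- The projection `Π_s`: the stage-`s` node on the path from the root to `ν`
(used for `1 ≤ s ≤ stage ν`). -/
def proj (s : ℕ) (ν : N) : N := tree.parent^[tree.stage ν - s] ν

end ScenarioTree

/-! ### Multistage programs on a scenario tree -/

/-- The data of a multistage program: the dimension `n_t` of the decisions of stage `t`, and at each
node `ν` of stage `t` the cost `g_t(·, ξ_t^ν)` and the feasibility mapping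
`X_t(x_{[t-1]}, ξ_{[t]}^ν)`.
An assignment of decisions to nodes is a nonanticipative policy; as an argument of `feas ν` only its
values at the strict ancestors of `ν`, the history `x_{[t-1]}`, matter (see `WellPosed`). -/
structure Program {T : ℕ} {N : Type*} (tree : ScenarioTree T N) where
  dim : ℕ → ℕ
  cost : (ν : N) → (Fin (dim (tree.stage ν)) → ℝ) → ℝ
  feas : (ν : N) → ((μ : N) → Fin (dim (tree.stage μ)) → ℝ) →
    Set (Fin (dim (tree.stage ν)) → ℝ)

/-- A real-valued polyhedral function on `ℝⁿ`: the pointwise maximum of finitely many (and at least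
one) affine functions. -/
def IsPolyhedralFunction {n : ℕ} (f : (Fin n → ℝ) → ℝ) : Prop :=
  ∃ (m : ℕ) (a : Fin m → Fin n → ℝ) (b : Fin m → ℝ),
    ∀ x, IsGreatest (Set.range fun i => a i ⬝ᵥ x + b i) (f x)

namespace Program

variable {T : ℕ} {N : Type*} {tree : ScenarioTree T N} (M : Program tree)

/-- Policies: a decision of stage `t` at each node of stage `t`. -/
abbrev Policy : Type _ := (ν : N) → Fin (M.dim (tree.stage ν)) → ℝ

/-- The history of decisions at the strict ancestors of `ν` is feasible. -/
def FeasibleHistory (ν : N) (x : M.Policy) : Prop :=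
  ∀ s ∈ Finset.Ico 1 (tree.stage ν), x (tree.proj s ν) ∈ M.feas (tree.proj s ν) x

/-- Standing assumptions: the costs are real-valued polyhedral functions; the feasibility mappings
are polyhedral (finitely many linear inequalities in the decision and in the decision history),
with non-empty compact values at feasible histories. -/
structure WellPosed : Prop where
  cost_polyhedral : ∀ ν, IsPolyhedralFunction (M.cost ν)
  feas_polyhedral : ∀ ν, ∃ (m : ℕ)
      (A : (s : ℕ) → Matrix (Fin m) (Fin (M.dim (tree.stage (tree.proj s ν)))) ℝ)
      (B : Matrix (Fin m) (Fin (M.dim (tree.stage ν))) ℝ) (b : Fin m → ℝ),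
      ∀ (x : M.Policy) (y : Fin (M.dim (tree.stage ν)) → ℝ),
        y ∈ M.feas ν x ↔ ∀ i : Fin m,
          ∑ s ∈ Finset.Ico 1 (tree.stage ν), (A s *ᵥ x (tree.proj s ν)) i + (B *ᵥ y) i ≤ b i
  feas_nonempty : ∀ ν x, M.FeasibleHistory ν x → (M.feas ν x).Nonempty
  feas_compact : ∀ ν x, M.FeasibleHistory ν x → IsCompact (M.feas ν x)

variable [Fintype N] [DecidableEq N]

/-- The worst-case expected problem at node `ν`: the maximum over the conditional ambiguity set `P`
of the expectation of the next-stage values `V`. -/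
def worstCase (tree : ScenarioTree T N) (ν : N) (P : Set (N → ℝ)) (V : N → ℝ) : ℝ :=
  sSup ((fun p => ∑ c ∈ tree.children ν, p c * V c) '' P)

/-- Backward recursion for the cost-to-go functions, by the number of remaining stages.
`P ν` is the conditional ambiguity set at node `ν`. -/
def valueAux (P : N → Set (N → ℝ)) : ℕ → N → M.Policy → ℝ
  | 0, ν, x => sInf (M.cost ν '' M.feas ν x)
  | k + 1, ν, x => sInf ((fun y => M.cost ν y +
      worstCase tree ν (P ν) fun c => valueAux P k c (Function.update x ν y)) '' M.feas ν x)

/-- The cost-to-go function `Q_t(x_{[t-1]}, ξ_{[t]}^ν)` at the node `ν` of stage `t`. -/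
def Q (P : N → Set (N → ℝ)) (ν : N) (x : M.Policy) : ℝ :=
  M.valueAux P (T - tree.stage ν) ν x

/-- The optimal value `Q_1` (at the root the history is vacuous). -/
def optimalValue (P : N → Set (N → ℝ)) : ℝ := M.Q P tree.root 0

/-- An optimal policy satisfying the dynamic programming equations: at every node it is feasible
and attains the cost-to-go function. -/
def IsOptimalPolicy (P : N → Set (N → ℝ)) (x : M.Policy) : Prop :=
  ∀ ν, x ν ∈ M.feas ν x ∧
    M.Q P ν x = M.cost ν (x ν) +
      if tree.stage ν < T then worstCase tree ν (P ν) fun c => M.Q P c x else 0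

end Program

/-! ### Effectiveness -/

section Effectiveness

variable {T : ℕ} {N : Type*} {tree : ScenarioTree T N}

/-- The ambiguity sets in which the conditional probabilities of the nodes in `S` are forced to be
zero. Nodes without a child in `S` keep their ambiguity sets. -/
def removeNodes [Fintype N] [DecidableEq N] (tree : ScenarioTree T N)
    (P : N → Set (N → ℝ)) (S : Set N) (ν : N) : Set (N → ℝ) :=
  {p ∈ P ν | ∀ c ∈ tree.children ν, c ∈ S → p c = 0}

variable [Fintype N] [DecidableEq N] (M : Program tree)

/-- The assessment problem of a set `S` of scenario paths (leaves) is well defined: no last-stage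
conditional ambiguity set becomes empty. -/
def AssessmentWellDefined (tree : ScenarioTree T N) (P : N → Set (N → ℝ)) (S : Set N) : Prop :=
  ∀ ν, tree.stage ν + 1 = T → (removeNodes tree P S ν).Nonempty

/-- A set `S` of scenario paths (leaves) is effective if the optimal value of its assessment problem
is smaller than that of the original problem, or, by convention, if the assessment problem is not
well defined. -/
def EffectivePaths (P : N → Set (N → ℝ)) (S : Set N) : Prop :=
  ¬ AssessmentWellDefined tree P S ∨
    M.optimalValue (removeNodes tree P S) < M.optimalValue P

/-- The optimal value `Q_t^CA(x_{[t-1]}, ξ_{[t]}^ν; S)` of the conditional assessment problem at a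
node `ν` of stage `t < T`, for a set `S` of nodes of stage `t + 1`. -/
def condAssessment (P : N → Set (N → ℝ)) (S : Set N) (ν : N) (x : M.Policy) : ℝ :=
  sInf ((fun y => M.cost ν y + Program.worstCase tree ν (removeNodes tree P S ν)
    fun c => M.Q P c (Function.update x ν y)) '' M.feas ν x)

/-- Conditional effectiveness, along the policy `x` and at the node `ν` of stage `t < T`, of a set
`S` of nodes of stage `t + 1`; with the same convention if the assessment problem is not well
defined. -/
def CondEffective (P : N → Set (N → ℝ)) (x : M.Policy) (S : Set N) (ν : N) : Prop :=
  removeNodes tree P S ν = ∅ ∨ condAssessment M P S ν x < M.Q P ν x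

end Effectiveness

/-! ### Total variation -/

/-- The conditional ambiguity set at `ν`: all probability vectors on the children of `ν` (extended by
zero to the other nodes) at total variation distance at most `γ ν` from the nominal conditional
distribution `q`. -/
def tvBall {T : ℕ} {N : Type*} [Fintype N] [DecidableEq N] (tree : ScenarioTree T N)
    (q γ : N → ℝ) (ν : N) : Set (N → ℝ) :=
  {p | (1 / 2) * ∑ c ∈ tree.children ν, |p c - q c| ≤ γ ν ∧
    ∑ c ∈ tree.children ν, p c = 1 ∧
    (∀ c ∈ tree.children ν, 0 ≤ p c) ∧ ∀ c, c ∉ tree.children ν → p c = 0}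

section Categories

variable {ι : Type*} (s : Finset ι) (q h : ι → ℝ) (γ : ℝ)

/-- The nominal distribution function `Ψ(η)` of the values `h`. -/
def cdf (η : ℝ) : ℝ := ∑ i ∈ s with h i ≤ η, q i

/-- The value-at-risk at level `γ`, `inf {η | Ψ(η) ≥ γ}`, in the extended reals
(it is finite for `0 < γ ≤ 1` and `-∞` for `γ = 0`). -/
def valueAtRisk : EReal := sInf ((fun η : ℝ => (η : EReal)) '' {η : ℝ | γ ≤ cdf s q h η})

/-- Primal category 1: the value is below the value-at-risk. -/
def cat₁ : Finset ι := {i ∈ s | (h i : EReal) < valueAtRisk s q h γ}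

/-- Primal category 2: the value is the value-at-risk. -/
def cat₂ : Finset ι := {i ∈ s | (h i : EReal) = valueAtRisk s q h γ}

/-- Primal category 3: the value is strictly between the value-at-risk and the supremum. -/
def cat₃ : Finset ι := {i ∈ s | valueAtRisk s q h γ < (h i : EReal) ∧ h i < sSup (h '' s)}

/-- Primal category 4: the value is the supremum. It is equal to category 2 if the value-at-risk
is the supremum, and disjoint from it otherwise. -/
def cat₄ : Finset ι := {i ∈ s | h i = sSup (h '' s)}

/-- The easy-to-check conditions that identify an element as effective. -/
def PassesEffectiveTest (i : ι) : Prop :=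
  i ∈ s ∧
    (γ < q i ∨
     (0 < γ ∧ cat₄ s h = {i}) ∨
     ((i ∈ cat₃ s q h γ ∨ i ∈ cat₄ s h) ∧ i ∉ cat₂ s q h γ ∧ 0 < q i) ∨
     (i ∈ cat₂ s q h γ ∧ γ < ∑ j ∈ cat₁ s q h γ, q j + q i))

/-- The easy-to-check conditions that identify an element as ineffective. -/
def PassesIneffectiveTest (i : ι) : Prop :=
  i ∈ s ∧
    (i ∈ cat₁ s q h γ ∨
     (q i = 0 ∧ (i ∉ cat₄ s h ∨ γ = 0)) ∨
     (i ∈ cat₂ s q h γ ∧ i ∉ cat₄ s h ∧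
       ∑ j ∈ cat₁ s q h γ, q j + ∑ j ∈ cat₂ s q h γ, q j = γ))

end Categories

section Identification

variable {T : ℕ} {N : Type*} {tree : ScenarioTree T N} [Fintype N] [DecidableEq N]
  (M : Program tree) (q γ : N → ℝ) (x : M.Policy)

/-- The values `h(ω_{t+1}) = g_t(x_t, ξ_t) + Q_{t+1}(x_{[t]}, ξ_{[t+1]})` of the children of `ν`
along the policy `x`. -/
def childValue (ν c : N) : ℝ := M.cost ν (x ν) + M.Q (tvBall tree q γ) c x

/-- The node `c` is identifiably conditionally effective along the optimal policy `x`. -/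
def IdentifiablyCondEffective (c : N) : Prop :=
  PassesEffectiveTest (tree.children (tree.parent c)) q
    (childValue M q γ x (tree.parent c)) (γ (tree.parent c)) c

/-- The node `c` is identifiably conditionally ineffective along the optimal policy `x`. -/
def IdentifiablyCondIneffective (c : N) : Prop :=
  PassesIneffectiveTest (tree.children (tree.parent c)) q
    (childValue M q γ x (tree.parent c)) (γ (tree.parent c)) c

end Identification

end MultistageDRO

end

/-! Everything rests on the nested objective `obj` of a fixed policy. It contains no minimization,
is finite and convex on the whole finite-dimensional policy space, and is therefore continuous. For
feasible policies it dominates the cost-to-go (`Q_le_obj`), with equality at the optimal policy x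
(`IsOptimalPolicy.obj_eq_Q`). The effect of removing a node c₀ is compared at an arbitrary strict
ancestor. The parent gives the conditional statements, and the root, with c₀ a leaf, gives the
statements about paths.

Inside a total variation ball, mass cannot be profitably moved away from a worst-case distribution.
This exchange principle (`IsWorstCase.le_of_pos`) shows that the effective tests force positive
worst-case mass (`IsWorstCase.pos`) and that the ineffective tests force zero mass
(`IsWorstCase.eq_zero`).

Effective paths: it suffices to keep x and see its objective drop. The drop is carried from c₀ to
each ancestor, since a worst-case distribution of the reduced problem either is not worst-case in
the original one or charges the path child (`obj_removeNodes_lt`).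

Ineffective nodes: other policies could profit from the removal, so equality of objectives at x is
not enough. The condition `IsDominated` survives small changes of the values, so by continuity the
two objectives agree near x (`eventually_obj_removeNodes_eq`). Then x is a local minimizer of the
reduced objective over a convex set of feasible policies, hence a global one. Nearly optimal
policies turn this into a bound on the reduced cost-to-go (`Q_le_Q_of_eventually_eq`). -/

namespace MultistageDRO

/-! ### Worst-case distributions in a total variation ball -/

section TotalVariation

variable {T : ℕ} {N : Type*} [Fintype N] [DecidableEq N] {tree : ScenarioTree T N}
  {q γ : N → ℝ} {ν : N} {p h : N → ℝ}

/-- `p` is a worst-case distribution in the ambiguity set `P` for the values `h` of the children. -/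
def IsWorstCase (tree : ScenarioTree T N) (ν : N) (P : Set (N → ℝ)) (h p : N → ℝ) : Prop :=
  p ∈ P ∧ ∀ p' ∈ P, ∑ c ∈ tree.children ν, p' c * h c ≤ ∑ c ∈ tree.children ν, p c * h c

/-- The mass that a distribution in a total variation ball removes from the nominal one. -/
lemma sum_deficit_eq (hq : ∑ c ∈ tree.children ν, q c = 1)
    (hp : p ∈ tvBall tree q γ ν) :
    ∑ c ∈ tree.children ν, max 0 (q c - p c) =
      (1 / 2) * ∑ c ∈ tree.children ν, |p c - q c| := by
  -- Both vectors have total mass one, so the linear terms cancel after summation.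
  have h1 : ∀ c, max 0 (q c - p c) = (1 / 2) * |p c - q c| + (1 / 2) * (q c - p c) := by
    intro c
    rcases le_total (p c) (q c) with h | h
    · rw [max_eq_right (by linarith), abs_of_nonpos (by linarith)]; ring
    · rw [max_eq_left (by linarith), abs_of_nonneg (by linarith)]; ring
  simp_rw [h1]
  rw [Finset.sum_add_distrib, ← Finset.mul_sum, ← Finset.mul_sum, Finset.sum_sub_distrib, hq,
    hp.2.1]
  ring

lemma sum_deficit_le (hq : ∑ c ∈ tree.children ν, q c = 1) (hp : p ∈ tvBall tree q γ ν) :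
    ∑ c ∈ tree.children ν, max 0 (q c - p c) ≤ γ ν := by
  rw [sum_deficit_eq hq hp]; exact hp.1

/-- The total deficit on a subset plus the deficit of a further element. -/
lemma sum_deficit_add_le (hq : ∑ c ∈ tree.children ν, q c = 1) (hp : p ∈ tvBall tree q γ ν)
    {s : Finset N} (hs : s ⊆ tree.children ν) {c : N} (hc : c ∈ tree.children ν) (hcs : c ∉ s) :
    ∑ i ∈ s, (q i - p i) + (q c - p c) ≤ γ ν := by
  refine le_trans ?_ (sum_deficit_le hq hp)
  rw [add_comm, ← Finset.sum_insert (f := fun i => q i - p i) hcs]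
  calc ∑ i ∈ insert c s, (q i - p i) ≤ ∑ i ∈ insert c s, max 0 (q i - p i) :=
        Finset.sum_le_sum fun i _ => le_max_right _ _
    _ ≤ _ := Finset.sum_le_sum_of_subset_of_nonneg (Finset.insert_subset hc hs)
        fun i _ _ => le_max_left _ _

/-- Moving mass `ε` from `i` to `j` inside a total variation ball. -/
lemma IsWorstCase.le_of_transfer (hp : IsWorstCase tree ν (tvBall tree q γ ν) h p) {i j : N}
    (hi : i ∈ tree.children ν) (hj : j ∈ tree.children ν) (hij : i ≠ j) {ε a b : ℝ} (hε : 0 < ε)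
    (hεp : ε ≤ p i) (ha : |p j + ε - q j| ≤ |p j - q j| + a)
    (hb : |p i - ε - q i| ≤ |p i - q i| + b)
    (hab : (1 / 2) * (∑ c ∈ tree.children ν, |p c - q c| + (a + b)) ≤ γ ν) : h j ≤ h i := by
  obtain ⟨⟨h1, h2, h3, h4⟩, hmax⟩ := hp
  -- The numbers a and b bound the change of the two affected terms of the distance; `hab` is the
  -- remaining budget condition for the perturbed vector.
  set p' : N → ℝ := fun c => p c + (if c = j then ε else 0) - (if c = i then ε else 0) with hp'
  have key : p' ∈ tvBall tree q γ ν := by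
    refine ⟨?_, ?_, ?_, ?_⟩
    · refine le_trans (mul_le_mul_of_nonneg_left ?_ (by norm_num)) hab
      calc ∑ c ∈ tree.children ν, |p' c - q c|
          ≤ ∑ c ∈ tree.children ν,
            (|p c - q c| + ((if c = j then a else 0) + (if c = i then b else 0))) := by
            refine Finset.sum_le_sum fun c _ => ?_
            by_cases hcj : c = j
            · have : c ≠ i := fun h => hij (h.symm.trans hcj)
              subst hcj; simpa [hp', this] using ha
            · by_cases hci : c = i
              · subst hci; simpa [hp', hcj] using hb
              · simp [hp', hcj, hci]
        _ = _ := by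
            rw [Finset.sum_add_distrib, Finset.sum_add_distrib]; simp [hi, hj]
    · simp [hp', Finset.sum_sub_distrib, Finset.sum_add_distrib, hi, hj, h2]
    · intro c hc
      have := h3 c hc
      by_cases hci : c = i
      · subst hci; simp only [hp', if_true, if_neg hij]; linarith
      · simp only [hp', if_neg hci]; split_ifs <;> linarith
    · intro c hc
      have hci : c ≠ i := fun h => hc (h ▸ hi)
      have hcj : c ≠ j := fun h => hc (h ▸ hj)
      simp [hp', hci, hcj, h4 c hc]
  have := hmax p' key
  have hsum : ∑ c ∈ tree.children ν, p' c * h c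
      = ∑ c ∈ tree.children ν, p c * h c + ε * h j - ε * h i := by
    simp [hp', sub_mul, add_mul, Finset.sum_sub_distrib, Finset.sum_add_distrib, ite_mul, hi, hj]
  rw [hsum] at this
  by_contra hcon
  nlinarith [mul_pos hε (sub_pos.2 (not_le.1 hcon))]

/-- The exchange principle: a worst-case distribution cannot be improved by moving mass from `i`
to `j` where this is feasible. -/
lemma IsWorstCase.le_of_pos (hp : IsWorstCase tree ν (tvBall tree q γ ν) h p) {i j : N}
    (hi : i ∈ tree.children ν) (hj : j ∈ tree.children ν) (hpi : 0 < p i)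
    (hex : p j < q j ∨ q i < p i ∨ (1 / 2) * ∑ c ∈ tree.children ν, |p c - q c| < γ ν) :
    h j ≤ h i := by
  rcases eq_or_ne i j with rfl | hij
  · exact le_rfl
  have h1 := hp.1.1
  have tri : ∀ (x y ε : ℝ), 0 < ε → |x + ε - y| ≤ |x - y| + ε := fun x y ε hε => by
    have := abs_add_le (x - y) ε
    rw [abs_of_pos hε] at this
    rwa [show x + ε - y = x - y + ε by ring]
  have tri' : ∀ (x y ε : ℝ), 0 < ε → |x - ε - y| ≤ |x - y| + ε := fun x y ε hε => by
    have := abs_sub (x - y) ε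
    rw [abs_of_pos hε] at this
    rwa [show x - ε - y = x - y - ε by ring]
  rcases hex with hex | hex | hex
  -- While j is below its nominal mass, its distance term falls by ε, which pays for the possible
  -- increase at i. The second case is symmetric, with i above its nominal mass. In the third case
  -- both terms may grow by ε, which the unused budget allows.
  · have hε : 0 < min (p i) (q j - p j) := lt_min hpi (by linarith)
    refine hp.le_of_transfer hi hj hij hε (min_le_left _ _)
      (a := -min (p i) (q j - p j)) ?_ (tri' _ _ _ hε) (by simpa using h1)
    have := min_le_right (p i) (q j - p j)
    rw [abs_of_nonpos (by linarith), abs_of_nonpos (by linarith)]; linarith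
  · have hε : 0 < min (p i) (p i - q i) := lt_min hpi (by linarith)
    refine hp.le_of_transfer hi hj hij hε (min_le_left _ _) (tri _ _ _ hε)
      (b := -min (p i) (p i - q i)) ?_ (by simpa using h1)
    have := min_le_right (p i) (p i - q i)
    rw [abs_of_nonneg (by linarith), abs_of_nonneg (by linarith)]; linarith
  · set τ := (1 / 2) * ∑ c ∈ tree.children ν, |p c - q c| with hτ
    have hε : 0 < min (p i) (γ ν - τ) := lt_min hpi (by linarith)
    refine hp.le_of_transfer hi hj hij hε (min_le_left _ _) (tri _ _ _ hε) (tri' _ _ _ hε) ?_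
    have := min_le_right (p i) (γ ν - τ)
    linarith

/-! ### Elements without mass -/

/-- A sufficient condition, stable under small perturbations of the values `h`, for `i` to have no
mass under every worst-case distribution. -/
def IsDominated {ι : Type*} (s : Finset ι) (q h : ι → ℝ) (γ : ℝ) (i : ι) : Prop :=
  (γ = 0 ∧ q i = 0) ∨ ∃ j ∈ s, h i < h j ∧ (q i = 0 ∨ cdf s q h (h i) ≤ γ)

/-- Suppose c kept mass although j is strictly better. No exchange is possible, so the budget is
exhausted and c is not above its nominal mass, which excludes q c = 0. Children with values above h
c have no deficit, so the whole deficit, at least γ, lies in the sublevel set of h c. There it is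
strictly smaller than the nominal mass, because c keeps some, and that mass is at most γ. If γ = 0
and q c = 0, the distance bound alone suffices. -/
lemma IsWorstCase.eq_zero (hp : IsWorstCase tree ν (tvBall tree q γ ν) h p)
    (hq0 : ∀ c, 0 ≤ q c) (hq : ∑ c ∈ tree.children ν, q c = 1) {c : N} (hc : c ∈ tree.children ν)
    (hd : IsDominated (tree.children ν) q h (γ ν) c) : p c = 0 := by
  have hpc := hp.1.2.2.1
  by_contra hne
  have hpos : 0 < p c := lt_of_le_of_ne (hpc c hc) (Ne.symm hne)
  rcases hd with ⟨hγ, hqc⟩ | ⟨j, hj, hlt, hd⟩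
  · have h1 := hp.1.1
    rw [hγ] at h1
    have h2 : |p c - q c| ≤ ∑ c ∈ tree.children ν, |p c - q c| :=
      Finset.single_le_sum (f := fun c => |p c - q c|) (fun _ _ => abs_nonneg _) hc
    rw [hqc, sub_zero, abs_of_pos hpos] at h2
    linarith
  · have hnot : ¬ (p j < q j ∨ q c < p c ∨
        (1 / 2) * ∑ c ∈ tree.children ν, |p c - q c| < γ ν) :=
      fun hex => not_le.2 hlt (hp.le_of_pos hc hj hpos hex)
    push Not at hnot
    obtain ⟨-, hqp, hτ⟩ := hnot
    rcases hd with hd | hd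
    · linarith
    · rw [← sum_deficit_eq hq hp.1] at hτ
      have hzero : ∀ i ∈ tree.children ν, ¬ h i ≤ h c → max 0 (q i - p i) = 0 := by
        intro i hi hic
        refine max_eq_left ?_
        by_contra hcon
        exact hic (hp.le_of_pos hc hi hpos (Or.inl (by linarith)))
      have : ∑ i ∈ tree.children ν, max 0 (q i - p i)
          = ∑ i ∈ tree.children ν with h i ≤ h c, max 0 (q i - p i) := by
        rw [Finset.sum_filter]
        refine Finset.sum_congr rfl fun i hi => ?_
        split_ifs with hic
        · rfl
        · exact hzero i hi hic
      have hlt' : ∑ i ∈ tree.children ν with h i ≤ h c, max 0 (q i - p i) <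
          cdf (tree.children ν) q h (h c) := by
        refine Finset.sum_lt_sum (fun i hi => ?_) ⟨c, by simp [hc], ?_⟩
        · exact max_le (hq0 i) (by linarith [hpc i (Finset.mem_filter.1 hi).1])
        · exact max_lt (by linarith) (by linarith)
      linarith

/-! ### The value-at-risk -/

section ValueAtRisk

variable {ι : Type*} {s : Finset ι} {q h : ι → ℝ} {γ : ℝ}

lemma cdf_lt_of_lt_valueAtRisk {η : ℝ} (hη : (η : EReal) < valueAtRisk s q h γ) :
    cdf s q h η < γ := by
  by_contra hcon
  exact not_le.2 hη (sInf_le ⟨η, not_lt.1 hcon, rfl⟩)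

lemma exists_cdf_ge_of_valueAtRisk_lt {η : ℝ} (hη : valueAtRisk s q h γ < (η : EReal)) :
    ∃ η' < η, γ ≤ cdf s q h η' := by
  obtain ⟨_, ⟨η', h1, rfl⟩, h2⟩ := sInf_lt_iff.1 hη
  exact ⟨η', EReal.coe_lt_coe_iff.1 h2, h1⟩

lemma le_sSup_image {i : ι} (hi : i ∈ s) : h i ≤ sSup (h '' s) :=
  le_csSup (s.finite_toSet.image h).bddAbove ⟨i, hi, rfl⟩

lemma exists_lt_of_notMem_cat₄ {i : ι} (hi : i ∈ s) (h4 : i ∉ cat₄ s h) : ∃ j ∈ s, h i < h j := by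
  have : h i < sSup (h '' s) :=
    lt_of_le_of_ne (le_sSup_image hi) fun he => h4 (Finset.mem_filter.2 ⟨hi, he⟩)
  obtain ⟨_, ⟨j, hj, rfl⟩, hlt⟩ := exists_lt_of_lt_csSup (Set.Nonempty.image h ⟨i, hi⟩) this
  exact ⟨j, hj, hlt⟩

lemma valueAtRisk_le_sSup (hq : ∑ i ∈ s, q i = 1) (hγ : γ ≤ 1) :
    valueAtRisk s q h γ ≤ ((sSup (h '' s) : ℝ) : EReal) := by
  refine sInf_le ⟨_, ?_, rfl⟩
  have : cdf s q h (sSup (h '' s)) = 1 := by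
    rw [cdf, Finset.filter_true_of_mem fun i hi => le_sSup_image hi, hq]
  simpa [this] using hγ

/-- Category 1 lies in the sublevel set of its largest value, which is below the value-at-risk.
Non-emptiness is needed: for γ = 0 the category is empty and the strict inequality fails. -/
lemma sum_cat₁_lt (hq0 : ∀ i, 0 ≤ q i) (hne : (cat₁ s q h γ).Nonempty) :
    ∑ i ∈ cat₁ s q h γ, q i < γ := by
  obtain ⟨m, hm, hmax⟩ := Finset.exists_max_image _ h hne
  refine lt_of_le_of_lt ?_ (cdf_lt_of_lt_valueAtRisk (Finset.mem_filter.1 hm).2)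
  refine Finset.sum_le_sum_of_subset_of_nonneg (fun i hi => ?_) fun i _ _ => hq0 i
  exact Finset.mem_filter.2 ⟨(Finset.mem_filter.1 hi).1, hmax i hi⟩

lemma cdf_eq_of_mem_cat₂ {i : ι} (hi : i ∈ cat₂ s q h γ) :
    cdf s q h (h i) = ∑ j ∈ cat₁ s q h γ, q j + ∑ j ∈ cat₂ s q h γ, q j := by
  classical
  have hv := (Finset.mem_filter.1 hi).2
  rw [← Finset.sum_union]
  · refine Finset.sum_congr ?_ fun _ _ => rfl
    ext j
    simp only [Finset.mem_filter, Finset.mem_union, cat₁, cat₂, ← hv, EReal.coe_lt_coe_iff,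
      EReal.coe_eq_coe_iff, le_iff_lt_or_eq]
    tauto
  · refine Finset.disjoint_filter.2 fun j _ h1 h2 => h1.ne h2

/-- Apart from the case γ = 0, each test excludes the maximal value, and so supplies a strictly
better element. In category 1 this is because the value-at-risk never exceeds the supremum. -/
lemma PassesIneffectiveTest.isDominated (hq : ∑ i ∈ s, q i = 1) (hγ : γ ≤ 1) {i : ι}
    (ht : PassesIneffectiveTest s q h γ i) : IsDominated s q h γ i := by
  obtain ⟨hi, h1 | ⟨hqi, h4 | hγ0⟩ | ⟨h2, h4, hsum⟩⟩ := ht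
  · have hlt := (Finset.mem_filter.1 h1).2
    have h4 : i ∉ cat₄ s h := fun h4 =>
      not_le.2 hlt ((Finset.mem_filter.1 h4).2 ▸ valueAtRisk_le_sSup hq hγ)
    obtain ⟨j, hj, hij⟩ := exists_lt_of_notMem_cat₄ hi h4
    exact Or.inr ⟨j, hj, hij, Or.inr (cdf_lt_of_lt_valueAtRisk hlt).le⟩
  · obtain ⟨j, hj, hij⟩ := exists_lt_of_notMem_cat₄ hi h4
    exact Or.inr ⟨j, hj, hij, Or.inl hqi⟩
  · exact Or.inl ⟨hγ0, hqi⟩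
  · obtain ⟨j, hj, hij⟩ := exists_lt_of_notMem_cat₄ hi h4
    exact Or.inr ⟨j, hj, hij, Or.inr (by rw [cdf_eq_of_mem_cat₂ h2, hsum])⟩

/-- Domination is an open condition in the values. -/
lemma IsDominated.eventually (hq0 : ∀ i, 0 ≤ q i) {X : Type*} {l : Filter X} {H : X → ι → ℝ}
    (hH : ∀ i, Filter.Tendsto (fun x => H x i) l (nhds (h i))) {i : ι}
    (hd : IsDominated s q h γ i) : ∀ᶠ x in l, IsDominated s q (H x) γ i := by
  rcases hd with hd | ⟨j, hj, hij, hd⟩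
  · exact Filter.Eventually.of_forall fun _ => Or.inl hd
  · have hlt : ∀ k, h i < h k → ∀ᶠ x in l, H x i < H x k := fun k hk =>
      (hH i).eventually_lt (hH k) hk
    -- Only strict inequalities are preserved; ties may break either way. Hence the sublevel set of
    -- the value at i can only shrink, and its nominal mass cannot increase.
    have hall : ∀ᶠ x in l, ∀ k ∈ s, h i < h k → H x i < H x k := by
      rw [Filter.eventually_all_finset]
      intro k _
      by_cases hk : h i < h k
      · filter_upwards [hlt k hk] with x hx _ using hx
      · exact Filter.Eventually.of_forall fun x h' => absurd h' hk
    filter_upwards [hall] with x hx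
    refine Or.inr ⟨j, hj, hx j hj hij, hd.imp_right fun hd => le_trans ?_ hd⟩
    refine Finset.sum_le_sum_of_subset_of_nonneg (fun k hk => ?_) fun k _ _ => hq0 k
    obtain ⟨hk, hle⟩ := Finset.mem_filter.1 hk
    exact Finset.mem_filter.2 ⟨hk, not_lt.1 fun hcon => not_lt.2 hle (hx k hk hcon)⟩

end ValueAtRisk

/-! ### Elements with mass -/

/-- An element that passes the test for effectiveness has mass under every worst-case
distribution. -/
lemma IsWorstCase.pos (hp : IsWorstCase tree ν (tvBall tree q γ ν) h p)
    (hq0 : ∀ c, 0 ≤ q c) (hq : ∑ c ∈ tree.children ν, q c = 1) (hγ : γ ν ≤ 1) {c : N}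
    (ht : PassesEffectiveTest (tree.children ν) q h (γ ν) c) : 0 < p c := by
  obtain ⟨hc, ht⟩ := ht
  have hp0 := hp.1.2.2.1
  refine lt_of_le_of_ne (hp0 c hc) fun hpc => ?_
  have hpc : p c = 0 := hpc.symm
  have hdef : ∀ s ⊆ tree.children ν, c ∉ s → ∑ i ∈ s, (q i - p i) + q c ≤ γ ν := fun s hs hcs => by
    simpa [hpc] using sum_deficit_add_le hq hp.1 hs hc hcs
  -- With c emptied, clearing s as well would remove more nominal mass than γ permits.
  have hbelow : ∀ s ⊆ tree.children ν, c ∉ s → γ ν < ∑ i ∈ s, q i + q c → ∃ i ∈ s, 0 < p i := by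
    intro s hs hcs hlt
    by_contra! hcon
    have h1 := hdef s hs hcs
    rw [Finset.sum_sub_distrib] at h1
    linarith [Finset.sum_nonpos hcon]
  have hexch : 0 < q c → ∀ i ∈ tree.children ν, 0 < p i → h c ≤ h i := fun hqc i hi hpi =>
    hp.le_of_pos hi hc hpi (Or.inl (by linarith))
  rcases ht with ht | ⟨hγ0, h4⟩ | ⟨h34, h2, hqc⟩ | ⟨h2, hlt⟩
  · have := hdef ∅ (Finset.empty_subset _) (Finset.notMem_empty c)
    simp at this
    linarith
  -- All mass sits on values strictly below that of c, so no exchange towards c may be feasible.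
  -- This forces p ≤ q, hence p = q with distance zero, yet also an exhausted budget, against γ > 0.
  · have hc4 : h c = sSup (h '' (tree.children ν)) :=
      (Finset.mem_filter.1 (h4 ▸ Finset.mem_singleton_self c : c ∈ cat₄ (tree.children ν) h)).2
    have huniq : ∀ i ∈ tree.children ν, 0 < p i → ¬ h c ≤ h i := by
      intro i hi hpi hle
      have : i ∈ cat₄ (tree.children ν) h :=
        Finset.mem_filter.2 ⟨hi, le_antisymm (le_sSup_image hi) (hc4 ▸ hle)⟩
      rw [h4, Finset.mem_singleton] at this
      rw [this, hpc] at hpi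
      exact lt_irrefl _ hpi
    have hnot : ∀ i ∈ tree.children ν, 0 < p i → ¬ (p c < q c ∨ q i < p i ∨
        (1 / 2) * ∑ c ∈ tree.children ν, |p c - q c| < γ ν) := fun i hi hpi hex =>
      huniq i hi hpi (hp.le_of_pos hi hc hpi hex)
    push Not at hnot
    have hle : ∀ i ∈ tree.children ν, p i ≤ q i := fun i hi => by
      rcases (hp0 i hi).eq_or_lt with h0 | h0
      · rw [← h0]; exact hq0 i
      · exact (hnot i hi h0).2.1
    have heq : ∀ i ∈ tree.children ν, p i = q i :=
      (Finset.sum_eq_sum_iff_of_le hle).1 (hp.1.2.1.trans hq.symm)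
    obtain ⟨i, hi, hpi⟩ : ∃ i ∈ tree.children ν, 0 < p i := by
      by_contra! hcon
      linarith [Finset.sum_nonpos hcon, hp.1.2.1]
    have hz : ∑ c ∈ tree.children ν, |p c - q c| = 0 :=
      Finset.sum_eq_zero fun i hi => by simp [heq i hi]
    have := (hnot i hi hpi).2.2
    rw [hz] at this
    linarith
  · have hv : valueAtRisk (tree.children ν) q h (γ ν) < (h c : EReal) := by
      rcases h34 with h3 | h4
      · exact (Finset.mem_filter.1 h3).2.1
      · refine lt_of_le_of_ne ?_ fun he => h2 (Finset.mem_filter.2 ⟨hc, he.symm⟩)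
        rw [(Finset.mem_filter.1 h4).2]
        exact valueAtRisk_le_sSup hq hγ
    -- A sublevel set strictly below h c already has nominal mass at least γ. Together with q c > 0
    -- this exceeds the budget, so some worse child keeps mass that should go to c.
    obtain ⟨η, hη, hcdf⟩ := exists_cdf_ge_of_valueAtRisk_lt hv
    obtain ⟨i, hi, hpi⟩ := hbelow {i ∈ tree.children ν | h i ≤ η} (Finset.filter_subset _ _)
      (fun hmem => not_lt.2 (Finset.mem_filter.1 hmem).2 hη) (by
        have : cdf (tree.children ν) q h η + q c > γ ν := by linarith
        exact this)
    obtain ⟨hi, hle⟩ := Finset.mem_filter.1 hi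
    linarith [hexch hqc i hi hpi]
  · have hv := (Finset.mem_filter.1 h2).2
    obtain ⟨i, hi, hpi⟩ := hbelow (cat₁ (tree.children ν) q h (γ ν)) (Finset.filter_subset _ _)
      (fun hmem => (Finset.mem_filter.1 hmem).2.ne hv) hlt
    -- Category 1 has nominal mass below γ, so the test inequality forces q c > 0 and the exchange
    -- towards c applies.
    have hlt1 := sum_cat₁_lt hq0 ⟨i, hi⟩
    obtain ⟨hi, hilt⟩ := Finset.mem_filter.1 hi
    have hle := hexch (by linarith) i hi hpi
    rw [← hv, EReal.coe_lt_coe_iff] at hilt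
    linarith

end TotalVariation


/-! ### Ancestors in a scenario tree -/

namespace ScenarioTree

variable {T : ℕ} {N : Type*} (tree : ScenarioTree T N)

lemma one_le_stage (ν : N) : 1 ≤ tree.stage ν := by
  by_cases h : ν = tree.root
  · rw [h, tree.stage_root]
  · rw [tree.stage_parent ν h]; omega

/-- The maximum with 1 absorbs the convention that the root is its own parent. -/
lemma stage_parent_eq (ν : N) : tree.stage (tree.parent ν) = max 1 (tree.stage ν - 1) := by
  by_cases h : ν = tree.root
  · rw [h, tree.parent_root, tree.stage_root]; rfl
  · have := tree.stage_parent ν h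
    have := tree.one_le_stage (tree.parent ν)
    omega

lemma stage_iterate_parent (m : ℕ) (ν : N) :
    tree.stage (tree.parent^[m] ν) = max 1 (tree.stage ν - m) := by
  induction m with
  | zero => have := tree.one_le_stage ν; simp; omega
  | succ m ih => rw [Function.iterate_succ_apply', stage_parent_eq, ih]; omega

lemma eq_root_of_stage_eq_one {ν : N} (h : tree.stage ν = 1) : ν = tree.root := by
  by_contra hne
  have := tree.stage_parent ν hne
  have := tree.one_le_stage (tree.parent ν)
  omega

lemma stage_proj {s : ℕ} {ν : N} (h1 : 1 ≤ s) (h2 : s ≤ tree.stage ν) :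
    tree.stage (tree.proj s ν) = s := by
  rw [proj, stage_iterate_parent]; omega

lemma proj_stage (ν : N) : tree.proj (tree.stage ν) ν = ν := by simp [proj]

lemma proj_pred {s : ℕ} {ν : N} (h1 : 1 ≤ s) (h2 : s ≤ tree.stage ν) :
    tree.proj (s - 1) ν = tree.parent (tree.proj s ν) := by
  rw [proj, proj, ← Function.iterate_succ_apply' (f := tree.parent)]
  congr 1; omega

variable [Fintype N] [DecidableEq N]

lemma mem_children {ν c : N} : c ∈ tree.children ν ↔ c ≠ tree.root ∧ tree.parent c = ν := by
  simp [children]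

lemma stage_of_mem_children {ν c : N} (h : c ∈ tree.children ν) :
    tree.stage c = tree.stage ν + 1 := by
  obtain ⟨h1, rfl⟩ := tree.mem_children.1 h
  exact tree.stage_parent c h1

lemma children_eq_empty {ν : N} (h : ¬ tree.stage ν < T) : tree.children ν = ∅ := by
  refine Finset.eq_empty_of_forall_notMem fun c hc => ?_
  have := tree.stage_of_mem_children hc
  have := tree.stage_le c
  omega

lemma mem_children_iterate {n : ℕ} {c : N} (h : n + 1 < tree.stage c) :
    tree.parent^[n] c ∈ tree.children (tree.parent^[n + 1] c) := by
  refine tree.mem_children.2 ⟨fun hr => ?_, (Function.iterate_succ_apply' _ _ _).symm⟩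
  have h1 := tree.stage_iterate_parent n c
  rw [hr, tree.stage_root] at h1
  omega

/-- A sibling of an ancestor of `c` (or of `c` itself) is not a strict ancestor of `c`. -/
lemma iterate_parent_ne_sibling {n : ℕ} {c d : N} (h : n + 1 < tree.stage c)
    (hd : d ∈ tree.children (tree.parent^[n + 1] c)) (hne : n = 0 ∨ d ≠ tree.parent^[n] c) (m : ℕ) :
    tree.parent^[m + 1] c ≠ d := by
  intro he
  have h1 := tree.stage_iterate_parent (m + 1) c
  have h2 := tree.stage_iterate_parent (n + 1) c
  have h3 := tree.stage_of_mem_children hd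
  rw [he] at h1
  have hmn : m + 1 = n := by omega
  rcases hne with hne | hne
  · omega
  · exact hne (hmn ▸ he.symm)

lemma proj_child {ν c : N} (hc : c ∈ tree.children ν) {s : ℕ} (hs : s ≤ tree.stage ν) :
    tree.proj s c = tree.proj s ν := by
  have h := tree.stage_of_mem_children hc
  rw [proj, proj, h, show tree.stage ν + 1 - s = (tree.stage ν - s) + 1 by omega,
    Function.iterate_succ_apply, (tree.mem_children.1 hc).2]

/-- Backward induction on a scenario tree. -/
theorem backward_induction {motive : N → Prop}
    (step : ∀ ν, (∀ c ∈ tree.children ν, motive c) → motive ν) (ν : N) : motive ν := by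
  obtain ⟨k, hk⟩ : ∃ k, k = T - tree.stage ν := ⟨_, rfl⟩
  induction k generalizing ν with
  | zero => exact step ν fun c hc => by rw [tree.children_eq_empty (by omega)] at hc; simp at hc
  | succ k ih =>
    exact step ν fun c hc => ih c (by have := tree.stage_of_mem_children hc; omega)

end ScenarioTree

/-! ### Families of ambiguity sets -/

section Ambiguity

variable {T : ℕ} {N : Type*} [Fintype N] [DecidableEq N] {tree : ScenarioTree T N}

/-- A family of compact conditional ambiguity sets, non-empty before the last stage. -/
structure IsAmbiguityFamily (tree : ScenarioTree T N) (P : N → Set (N → ℝ)) : Prop where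
  nonempty : ∀ ν, tree.stage ν < T → (P ν).Nonempty
  isCompact : ∀ ν, IsCompact (P ν)
  nonneg : ∀ ν, ∀ p ∈ P ν, ∀ c ∈ tree.children ν, 0 ≤ p c
  sum_eq_one : ∀ ν, ∀ p ∈ P ν, ∑ c ∈ tree.children ν, p c = 1

lemma continuous_expectation (ν : N) (V : N → ℝ) :
    Continuous fun p : N → ℝ => ∑ c ∈ tree.children ν, p c * V c := by fun_prop

lemma IsAmbiguityFamily.tvBall {q γ : N → ℝ} (hq0 : ∀ c, 0 ≤ q c)
    (hq : ∀ ν, tree.stage ν < T → ∑ c ∈ tree.children ν, q c = 1) (hγ : ∀ ν, 0 ≤ γ ν) :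
    IsAmbiguityFamily tree (tvBall tree q γ) where
  nonempty ν hν := by
    refine ⟨fun c => if c ∈ tree.children ν then q c else 0, ?_, ?_, ?_, ?_⟩
    · rw [Finset.sum_eq_zero fun c hc => by simp [hc]]; simpa using hγ ν
    · rw [← hq ν hν]; exact Finset.sum_congr rfl fun c hc => by simp [hc]
    · intro c hc; simp [hc, hq0 c]
    · intro c hc; simp [hc]
  isCompact ν := by
    refine (isCompact_Icc (a := (0 : N → ℝ)) (b := 1)).of_isClosed_subset ?_ ?_
    · have h1 : IsClosed {p : N → ℝ | (1 / 2) * ∑ c ∈ tree.children ν, |p c - q c| ≤ γ ν} :=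
        isClosed_le (by fun_prop) continuous_const
      have h2 : IsClosed {p : N → ℝ | ∑ c ∈ tree.children ν, p c = 1} :=
        isClosed_eq (by fun_prop) continuous_const
      have h3 : IsClosed {p : N → ℝ | ∀ c ∈ tree.children ν, 0 ≤ p c} := by
        simp only [Set.ofPred_forall]
        exact isClosed_iInter fun c => isClosed_iInter fun _ =>
          isClosed_le continuous_const (continuous_apply c)
      have h4 : IsClosed {p : N → ℝ | ∀ c, c ∉ tree.children ν → p c = 0} := by
        simp only [Set.ofPred_forall]
        exact isClosed_iInter fun c => isClosed_iInter fun _ =>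
          isClosed_eq (continuous_apply c) continuous_const
      exact h1.inter (h2.inter (h3.inter h4))
    · rintro p ⟨-, h2, h3, h4⟩
      refine ⟨fun c => ?_, fun c => ?_⟩ <;> by_cases hc : c ∈ tree.children ν
      · exact h3 c hc
      · simp [h4 c hc]
      · simpa [← h2] using Finset.single_le_sum (f := p) h3 hc
      · simp [h4 c hc]
  nonneg ν p hp := hp.2.2.1
  sum_eq_one ν p hp := hp.2.1

lemma removeNodes_subset (P : N → Set (N → ℝ)) (S : Set N) (ν : N) :
    removeNodes tree P S ν ⊆ P ν := fun _ hp => hp.1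

lemma removeNodes_eq_self (P : N → Set (N → ℝ)) {c ν : N} (h : c ∉ tree.children ν) :
    removeNodes tree P {c} ν = P ν := by
  refine Set.Subset.antisymm (removeNodes_subset P _ ν) fun p hp => ⟨hp, ?_⟩
  rintro d hd rfl
  exact absurd hd h

lemma IsAmbiguityFamily.removeNodes {P : N → Set (N → ℝ)} (hP : IsAmbiguityFamily tree P) {c : N}
    (hne : (removeNodes tree P {c} (tree.parent c)).Nonempty) :
    IsAmbiguityFamily tree (removeNodes tree P {c}) where
  nonempty ν hν := by
    by_cases h : c ∈ tree.children ν
    · rwa [← (tree.mem_children.1 h).2]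
    · rw [removeNodes_eq_self P h]; exact hP.nonempty ν hν
  isCompact ν := by
    have hcl : IsClosed {p : N → ℝ | ∀ d ∈ tree.children ν, d ∈ ({c} : Set N) → p d = 0} := by
      simp only [Set.ofPred_forall]
      exact isClosed_iInter fun c => isClosed_iInter fun _ => isClosed_iInter fun _ =>
        isClosed_eq (continuous_apply c) continuous_const
    exact (hP.isCompact ν).inter_right hcl
  nonneg ν p hp := hP.nonneg ν p hp.1
  sum_eq_one ν p hp := hP.sum_eq_one ν p hp.1

namespace Program

variable {P P' : N → Set (N → ℝ)} {ν : N} {V V' : N → ℝ}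

lemma le_worstCase (hP : IsAmbiguityFamily tree P) {p : N → ℝ} (hp : p ∈ P ν) :
    ∑ c ∈ tree.children ν, p c * V c ≤ worstCase tree ν (P ν) V :=
  le_csSup ((hP.isCompact ν).image (continuous_expectation ν V)).bddAbove ⟨p, hp, rfl⟩

lemma exists_isWorstCase (hP : IsAmbiguityFamily tree P) (hν : tree.stage ν < T) (V : N → ℝ) :
    ∃ p, IsWorstCase tree ν (P ν) V p ∧
      ∑ c ∈ tree.children ν, p c * V c = worstCase tree ν (P ν) V := by
  obtain ⟨p, hp, he⟩ := ((hP.isCompact ν).image (continuous_expectation ν V)).sSup_mem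
    ((hP.nonempty ν hν).image _)
  refine ⟨p, ⟨hp, fun p' hp' => ?_⟩, he⟩
  exact (le_worstCase hP hp').trans_eq he.symm

/-- Without children every expectation is zero, and so is the supremum, even over an empty set. This
lets a single recursive equation cover all stages, the last included. -/
lemma worstCase_eq_zero (hν : ¬ tree.stage ν < T) (S : Set (N → ℝ)) (V : N → ℝ) :
    worstCase tree ν S V = 0 := by
  simp only [worstCase, tree.children_eq_empty hν, Finset.sum_empty]
  rcases S.eq_empty_or_nonempty with rfl | hS
  · simp
  · simp [hS.image_const]

lemma worstCase_congr (S : Set (N → ℝ)) (h : ∀ c ∈ tree.children ν, V c = V' c) :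
    worstCase tree ν S V = worstCase tree ν S V' := by
  have : (fun p : N → ℝ => ∑ c ∈ tree.children ν, p c * V c)
      = fun p => ∑ c ∈ tree.children ν, p c * V' c :=
    funext fun p => Finset.sum_congr rfl fun c hc => by rw [h c hc]
  rw [worstCase, worstCase, this]

/-- A maximizer for V is a candidate in the larger set, and its total mass one turns the uniform
error into a. The sign of a matters only at the last stage, where both worst cases are zero. -/
lemma worstCase_le_add (hP : IsAmbiguityFamily tree P) (hP' : IsAmbiguityFamily tree P')
    (hsub : P ν ⊆ P' ν) {a : ℝ} (ha : 0 ≤ a) (h : ∀ c ∈ tree.children ν, V c ≤ V' c + a) :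
    worstCase tree ν (P ν) V ≤ worstCase tree ν (P' ν) V' + a := by
  by_cases hν : tree.stage ν < T
  · obtain ⟨p, hp, he⟩ := exists_isWorstCase hP hν V
    rw [← he]
    calc ∑ c ∈ tree.children ν, p c * V c ≤ ∑ c ∈ tree.children ν, (p c * V' c + p c * a) :=
          Finset.sum_le_sum fun c hc => by
            rw [← mul_add]; exact mul_le_mul_of_nonneg_left (h c hc) (hP.nonneg ν p hp.1 c hc)
      _ = ∑ c ∈ tree.children ν, p c * V' c + a := by
          rw [Finset.sum_add_distrib, ← Finset.sum_mul, hP.sum_eq_one ν p hp.1, one_mul]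
      _ ≤ _ := by linarith [le_worstCase (V := V') hP' (hsub hp.1)]
  · rw [worstCase_eq_zero hν, worstCase_eq_zero hν]; linarith

lemma worstCase_mono (hP : IsAmbiguityFamily tree P) (hP' : IsAmbiguityFamily tree P')
    (hsub : P ν ⊆ P' ν) (h : ∀ c ∈ tree.children ν, V c ≤ V' c) :
    worstCase tree ν (P ν) V ≤ worstCase tree ν (P' ν) V' := by
  simpa using worstCase_le_add hP hP' hsub le_rfl fun c hc => by simpa using h c hc

/-- The worst case is a supremum of linear functionals with non-negative weights, hence monotone and
sublinear. -/
lemma worstCase_convex (hP : IsAmbiguityFamily tree P) {W : N → ℝ} {a b : ℝ} (ha : 0 ≤ a)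
    (hb : 0 ≤ b) (h : ∀ c ∈ tree.children ν, W c ≤ a * V c + b * V' c) :
    worstCase tree ν (P ν) W ≤ a * worstCase tree ν (P ν) V + b * worstCase tree ν (P ν) V' := by
  by_cases hν : tree.stage ν < T
  · obtain ⟨p, hp, he⟩ := exists_isWorstCase hP hν W
    rw [← he]
    calc ∑ c ∈ tree.children ν, p c * W c
        ≤ ∑ c ∈ tree.children ν, (a * (p c * V c) + b * (p c * V' c)) :=
          Finset.sum_le_sum fun c hc =>
            (mul_le_mul_of_nonneg_left (h c hc) (hP.nonneg ν p hp.1 c hc)).trans_eq (by ring)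
      _ = a * ∑ c ∈ tree.children ν, p c * V c + b * ∑ c ∈ tree.children ν, p c * V' c := by
          rw [Finset.sum_add_distrib, ← Finset.mul_sum, ← Finset.mul_sum]
      _ ≤ _ := by gcongr <;> exact le_worstCase hP hp.1
  · simp [worstCase_eq_zero hν]

end Program

end Ambiguity

/-! ### Cost-to-go functions and policy objectives -/

namespace Program

variable {T : ℕ} {N : Type*} {tree : ScenarioTree T N} {M : Program tree}

/-- Two policies prescribe the same decisions at the strict ancestors of `ν`. -/
def SameHistory (ν : N) (x x' : M.Policy) : Prop :=
  ∀ s ∈ Finset.Ico 1 (tree.stage ν), x (tree.proj s ν) = x' (tree.proj s ν)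

lemma SameHistory.of_stage {ν : N} {x x' : M.Policy}
    (h : ∀ μ, tree.stage μ < tree.stage ν → x μ = x' μ) : SameHistory ν x x' := fun s hs => by
  obtain ⟨h1, h2⟩ := Finset.mem_Ico.1 hs
  exact h _ (by rwa [tree.stage_proj h1 h2.le])

lemma feas_congr (hM : M.WellPosed) {ν : N} {x x' : M.Policy} (h : SameHistory ν x x') :
    M.feas ν x = M.feas ν x' := by
  obtain ⟨m, A, B, b, hAB⟩ := hM.feas_polyhedral ν
  ext y
  rw [hAB, hAB]
  refine forall_congr' fun i => ?_
  rw [Finset.sum_congr rfl fun s hs => by rw [h s hs]]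

/-- A convex combination of decisions feasible for two histories is feasible for the combined
history. -/
lemma feas_convex (hM : M.WellPosed) {ν : N} {x x' : M.Policy}
    {y y' : Fin (M.dim (tree.stage ν)) → ℝ} (hy : y ∈ M.feas ν x) (hy' : y' ∈ M.feas ν x')
    {a b : ℝ} (ha : 0 ≤ a) (hb : 0 ≤ b) (hab : a + b = 1) :
    a • y + b • y' ∈ M.feas ν (a • x + b • x') := by
  obtain ⟨m, A, B, c, hAB⟩ := hM.feas_polyhedral ν
  rw [hAB] at hy hy' ⊢
  intro i
  have h1 := mul_le_mul_of_nonneg_left (hy i) ha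
  have h2 := mul_le_mul_of_nonneg_left (hy' i) hb
  have h3 : ∑ s ∈ Finset.Ico 1 (tree.stage ν), (A s *ᵥ (a • x + b • x') (tree.proj s ν)) i
      = a * ∑ s ∈ Finset.Ico 1 (tree.stage ν), (A s *ᵥ x (tree.proj s ν)) i
        + b * ∑ s ∈ Finset.Ico 1 (tree.stage ν), (A s *ᵥ x' (tree.proj s ν)) i := by
    rw [Finset.mul_sum, Finset.mul_sum, ← Finset.sum_add_distrib]
    refine Finset.sum_congr rfl fun s _ => ?_
    simp [Matrix.mulVec_add, Matrix.mulVec_smul]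
  have h4 : (B *ᵥ (a • y + b • y')) i = a * (B *ᵥ y) i + b * (B *ᵥ y') i := by
    simp [Matrix.mulVec_add, Matrix.mulVec_smul]
  rw [h3, h4]
  calc _ = a * (∑ s ∈ Finset.Ico 1 (tree.stage ν), (A s *ᵥ x (tree.proj s ν)) i + (B *ᵥ y) i)
        + b * (∑ s ∈ Finset.Ico 1 (tree.stage ν), (A s *ᵥ x' (tree.proj s ν)) i
          + (B *ᵥ y') i) := by ring
    _ ≤ a * c i + b * c i := add_le_add h1 h2
    _ = c i := by rw [← add_mul, hab, one_mul]

lemma cost_convexOn (hM : M.WellPosed) (ν : N) : ConvexOn ℝ Set.univ (M.cost ν) := by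
  obtain ⟨m, a, b, h⟩ := hM.cost_polyhedral ν
  refine ⟨convex_univ, fun x _ y _ s t hs ht hst => ?_⟩
  obtain ⟨⟨i, hi⟩, -⟩ := h (s • x + t • y)
  have h1 : a i ⬝ᵥ x + b i ≤ M.cost ν x := (h x).2 ⟨i, rfl⟩
  have h2 : a i ⬝ᵥ y + b i ≤ M.cost ν y := (h y).2 ⟨i, rfl⟩
  rw [← hi]
  calc a i ⬝ᵥ (s • x + t • y) + b i = s * (a i ⬝ᵥ x + b i) + t * (a i ⬝ᵥ y + b i) := by
        simp only [dotProduct_add, dotProduct_smul, smul_eq_mul]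
        linear_combination -b i * hst
    _ ≤ _ := add_le_add (mul_le_mul_of_nonneg_left h1 hs) (mul_le_mul_of_nonneg_left h2 ht)

variable [DecidableEq N]

lemma SameHistory.update_right (ν : N) (x : M.Policy) (y : Fin (M.dim (tree.stage ν)) → ℝ) :
    SameHistory ν x (Function.update x ν y) :=
  SameHistory.of_stage fun μ hμ => by rw [Function.update_of_ne (by rintro rfl; omega)]

variable [Fintype N]

lemma SameHistory.update {ν c : N} (hc : c ∈ tree.children ν) {x x' : M.Policy}
    (h : SameHistory ν x x') (y : Fin (M.dim (tree.stage ν)) → ℝ) :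
    SameHistory c (Function.update x ν y) (Function.update x' ν y) := by
  intro s hs
  rw [tree.stage_of_mem_children hc, Finset.mem_Ico] at hs
  rw [tree.proj_child hc (by omega)]
  by_cases he : tree.proj s ν = ν
  · rw [he]; simp
  · rw [Function.update_of_ne he, Function.update_of_ne he]
    refine h s (Finset.mem_Ico.2 ⟨hs.1, lt_of_le_of_ne (by omega) fun hs' => he ?_⟩)
    rw [hs', tree.proj_stage]

lemma FeasibleHistory.update (hM : M.WellPosed) {ν c : N} (hc : c ∈ tree.children ν)
    {x : M.Policy} (h : M.FeasibleHistory ν x) {y : Fin (M.dim (tree.stage ν)) → ℝ}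
    (hy : y ∈ M.feas ν x) : M.FeasibleHistory c (Function.update x ν y) := by
  intro s hs
  rw [tree.stage_of_mem_children hc, Finset.mem_Ico] at hs
  rw [tree.proj_child hc (by omega)]
  rcases Nat.lt_succ_iff_lt_or_eq.1 hs.2 with hlt | rfl
  · have hst := tree.stage_proj hs.1 hlt.le
    have hne : tree.proj s ν ≠ ν := fun he => by rw [he] at hst; omega
    rw [Function.update_of_ne hne, ← feas_congr hM (x := x)]
    · exact h s (Finset.mem_Ico.2 ⟨hs.1, hlt⟩)
    · refine SameHistory.of_stage fun μ hμ => ?_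
      rw [Function.update_of_ne (by rintro rfl; omega)]
  · rw [tree.proj_stage, Function.update_self, ← feas_congr hM (SameHistory.update_right ν x y)]
    exact hy

/-- The dynamic programming equation, uniformly in the stage. -/
lemma Q_eq (P : N → Set (N → ℝ)) (ν : N) (x : M.Policy) :
    M.Q P ν x = sInf ((fun y => M.cost ν y +
      worstCase tree ν (P ν) fun c => M.Q P c (Function.update x ν y)) '' M.feas ν x) := by
  by_cases hν : tree.stage ν < T
  · obtain ⟨k, hk⟩ : ∃ k, T - tree.stage ν = k + 1 := ⟨T - tree.stage ν - 1, by omega⟩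
    rw [Q, hk, valueAux]
    congr 2
    funext y
    congr 1
    refine worstCase_congr _ fun c hc => ?_
    rw [Q, tree.stage_of_mem_children hc, show T - (tree.stage ν + 1) = k by omega]
  · rw [Q, show T - tree.stage ν = 0 by omega, valueAux]
    simp only [worstCase_eq_zero hν, add_zero]

lemma Q_congr_history (hM : M.WellPosed) (P : N → Set (N → ℝ)) (ν : N) :
    ∀ {x x' : M.Policy}, SameHistory ν x x' → M.Q P ν x = M.Q P ν x' := by
  induction ν using tree.backward_induction with | step ν ih => ?_
  intro x x' h
  rw [Q_eq, Q_eq, feas_congr hM h]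
  congr 2
  funext y
  congr 1
  exact worstCase_congr _ fun c hc => ih c hc (h.update hc y)

/-- Removing `c` changes nothing at nodes that are not strict ancestors of `c`. -/
lemma Q_removeNodes_eq (P : N → Set (N → ℝ)) {c : N} (ν : N) :
    (∀ m, tree.parent^[m + 1] c ≠ ν) → ∀ x, M.Q (removeNodes tree P {c}) ν x = M.Q P ν x := by
  induction ν using tree.backward_induction with | step ν ih => ?_
  intro hc x
  rw [Q_eq, Q_eq, removeNodes_eq_self P fun hmem => hc 0 (tree.mem_children.1 hmem).2]
  congr 2
  funext y
  congr 1
  -- If the child d were a strict ancestor of c, its parent ν would be one too, at the next iterate.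
  refine worstCase_congr _ fun d hd => ih d hd (fun m hm => hc (m + 1) ?_) _
  rw [Function.iterate_succ_apply', hm, (tree.mem_children.1 hd).2]

/-! ### Nested objectives of fixed policies -/

/-- The objective of a policy `x` in the subtree of `ν`, by the number of remaining stages. -/
noncomputable def objAux (M : Program tree) (P : N → Set (N → ℝ)) : ℕ → N → M.Policy → ℝ
  | 0, ν, x => M.cost ν (x ν)
  | k + 1, ν, x => M.cost ν (x ν) + worstCase tree ν (P ν) fun c => objAux M P k c x

/-- The nested worst-case objective of a policy `x` in the subtree of `ν`. -/
noncomputable def obj (M : Program tree) (P : N → Set (N → ℝ)) (ν : N) (x : M.Policy) : ℝ :=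
  M.objAux P (T - tree.stage ν) ν x

lemma obj_eq (P : N → Set (N → ℝ)) (ν : N) (x : M.Policy) :
    M.obj P ν x = M.cost ν (x ν) + worstCase tree ν (P ν) fun c => M.obj P c x := by
  by_cases hν : tree.stage ν < T
  · obtain ⟨k, hk⟩ : ∃ k, T - tree.stage ν = k + 1 := ⟨T - tree.stage ν - 1, by omega⟩
    rw [obj, hk, objAux]
    congr 1
    refine worstCase_congr _ fun c hc => ?_
    rw [obj, tree.stage_of_mem_children hc, show T - (tree.stage ν + 1) = k by omega]
  · rw [obj, show T - tree.stage ν = 0 by omega, objAux, worstCase_eq_zero hν, add_zero]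

lemma obj_removeNodes_eq (P : N → Set (N → ℝ)) {c : N} (ν : N) :
    (∀ m, tree.parent^[m + 1] c ≠ ν) →
      ∀ x, M.obj (removeNodes tree P {c}) ν x = M.obj P ν x := by
  induction ν using tree.backward_induction with | step ν ih => ?_
  intro hc x
  rw [obj_eq, obj_eq, removeNodes_eq_self P fun hmem => hc 0 (tree.mem_children.1 hmem).2]
  congr 1
  refine worstCase_congr _ fun d hd => ih d hd (fun m hm => hc (m + 1) ?_) _
  rw [Function.iterate_succ_apply', hm, (tree.mem_children.1 hd).2]

variable {P P' : N → Set (N → ℝ)}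

lemma obj_mono (hP : IsAmbiguityFamily tree P) (hP' : IsAmbiguityFamily tree P')
    (hsub : ∀ ν, P ν ⊆ P' ν) (x : M.Policy) (ν : N) : M.obj P ν x ≤ M.obj P' ν x := by
  induction ν using tree.backward_induction with | step ν ih => ?_
  rw [obj_eq, obj_eq]
  exact add_le_add_right (worstCase_mono hP hP' (hsub ν) ih) _

/-- The costs are convex and the worst case preserves convexity. The domain is the whole policy
space, because feasibility does not enter the objective. -/
lemma obj_convexOn (hM : M.WellPosed) (hP : IsAmbiguityFamily tree P) (ν : N) :
    ConvexOn ℝ Set.univ (M.obj P ν) := by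
  induction ν using tree.backward_induction with | step ν ih => ?_
  refine ⟨convex_univ, fun x _ x' _ a b ha hb hab => ?_⟩
  rw [obj_eq, obj_eq, obj_eq]
  have h1 := (cost_convexOn hM ν).2 (Set.mem_univ (x ν)) (Set.mem_univ (x' ν)) ha hb hab
  have h2 := worstCase_convex (ν := ν) hP ha hb fun c hc =>
    (ih c hc).2 (Set.mem_univ x) (Set.mem_univ x') ha hb hab
  simp only [smul_eq_mul, Pi.add_apply, Pi.smul_apply] at h1 h2 ⊢
  linarith

/-- A finite convex function on a finite-dimensional space is locally Lipschitz. -/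
lemma obj_continuous (hM : M.WellPosed) (hP : IsAmbiguityFamily tree P) (ν : N) :
    Continuous (M.obj P ν) :=
  (obj_convexOn hM hP ν).locallyLipschitz.continuous

/-- At a policy satisfying the dynamic programming equations the objective is the cost-to-go. -/
lemma IsOptimalPolicy.obj_eq_Q {x : M.Policy} (hx : M.IsOptimalPolicy P x) (ν : N) :
    M.obj P ν x = M.Q P ν x := by
  induction ν using tree.backward_induction with | step ν ih => ?_
  rw [obj_eq, (hx ν).2, worstCase_congr _ ih]
  split_ifs with hν
  · rfl
  · rw [worstCase_eq_zero hν]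

end Program


namespace Program

variable {T : ℕ} {N : Type*} {tree : ScenarioTree T N} {M : Program tree} [Fintype N]

/-! ### Boundedness -/

/-- The feasible sets are bounded, uniformly over bounded sets of histories. -/
lemma feas_bounded (hM : M.WellPosed) {ν : N} {x₀ : M.Policy} (h₀ : M.FeasibleHistory ν x₀)
    (R : ℝ) : ∃ R', ∀ x : M.Policy, ‖x‖ ≤ R → ∀ y ∈ M.feas ν x, ‖y‖ ≤ R' := by
  obtain ⟨m, A, B, b, hAB⟩ := hM.feas_polyhedral ν
  obtain ⟨z, hz⟩ := hM.feas_nonempty ν x₀ h₀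
  obtain ⟨C, hC⟩ := (hM.feas_compact ν x₀ h₀).isBounded.exists_norm_le
  -- The recession cone depends only on B, not on the history, so compactness at the single history
  -- x₀ makes it trivial. The scale r below pushes z + r d beyond the norm bound C.
  have hdir : ∀ d, (∀ i, (B *ᵥ d) i ≤ 0) → d = 0 := by
    intro d hd
    by_contra hne
    have hpos : 0 < ‖d‖ := norm_pos_iff.2 hne
    set r := (C + ‖z‖ + 1) / ‖d‖ with hr
    have hC0 : 0 ≤ C := (norm_nonneg z).trans (hC z hz)
    have hr0 : 0 ≤ r := by positivity
    have hmem : z + r • d ∈ M.feas ν x₀ := by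
      rw [hAB] at hz ⊢
      intro i
      have := hz i
      rw [Matrix.mulVec_add, Matrix.mulVec_smul, Pi.add_apply, Pi.smul_apply, smul_eq_mul]
      linarith [mul_nonpos_of_nonneg_of_nonpos hr0 (hd i)]
    have h1 : ‖r • d‖ = C + ‖z‖ + 1 := by
      rw [norm_smul, Real.norm_of_nonneg hr0, hr, div_mul_cancel₀ _ hpos.ne']
    have h2 : ‖r • d‖ ≤ ‖z + r • d‖ + ‖z‖ := by
      simpa using norm_sub_le (z + r • d) z
    linarith [hC _ hmem]
  -- This function is positively homogeneous and positive away from zero, so it dominates δ times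
  -- the norm. On the feasible set it is bounded by G, a continuous function of the history.
  set φ : (Fin (M.dim (tree.stage ν)) → ℝ) → ℝ := fun d => ∑ i, max 0 ((B *ᵥ d) i) with hφ
  have hφc : Continuous φ := by
    simp only [hφ, Matrix.mulVec, dotProduct]
    fun_prop
  obtain ⟨δ, hδ, hδφ⟩ := (isCompact_sphere (0 : Fin (M.dim (tree.stage ν)) → ℝ) 1).exists_forall_le'
    hφc.continuousOn (a := 0) fun d hd => by
      refine lt_of_le_of_ne (Finset.sum_nonneg fun i _ => le_max_left _ _) fun he => ?_
      have h0 := (Finset.sum_eq_zero_iff_of_nonneg fun i _ => le_max_left _ _).1 he.symm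
      have := hdir d fun i => max_eq_left_iff.1 (h0 i (Finset.mem_univ i))
      rw [this] at hd
      simp at hd
  set G : M.Policy → ℝ := fun x =>
    ∑ i, |b i - ∑ s ∈ Finset.Ico 1 (tree.stage ν), (A s *ᵥ x (tree.proj s ν)) i| with hG
  have hGc : Continuous G := by
    simp only [hG, Matrix.mulVec, dotProduct]
    fun_prop
  obtain ⟨K, hK⟩ := (isCompact_closedBall (0 : M.Policy) R).exists_bound_of_continuousOn
    hGc.continuousOn
  refine ⟨K / δ, fun x hx y hy => ?_⟩
  have hGK : G x ≤ K := (le_abs_self _).trans (hK x (by simpa using hx))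
  have hφG : φ y ≤ G x := Finset.sum_le_sum fun i _ =>
    max_le (abs_nonneg _) (le_trans (by linarith [(hAB x y).1 hy i]) (le_abs_self _))
  have hφy : ‖y‖ * δ ≤ φ y := by
    rcases eq_or_ne y 0 with rfl | hne
    · simpa using Finset.sum_nonneg fun i _ => le_max_left _ _
    · have hpos : 0 < ‖y‖ := norm_pos_iff.2 hne
      have h1 := hδφ (‖y‖⁻¹ • y) (by simp [norm_smul, hpos.ne'])
      have h2 : φ (‖y‖⁻¹ • y) = ‖y‖⁻¹ * φ y := by
        simp only [hφ, Finset.mul_sum, Matrix.mulVec_smul, Pi.smul_apply, smul_eq_mul]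
        refine Finset.sum_congr rfl fun i _ => ?_
        rw [mul_max_of_nonneg _ _ (by positivity), mul_zero]
      rw [h2] at h1
      calc ‖y‖ * δ ≤ ‖y‖ * (‖y‖⁻¹ * φ y) := by gcongr
        _ = φ y := by rw [← mul_assoc, mul_inv_cancel₀ hpos.ne', one_mul]
  rw [le_div_iff₀ hδ]
  linarith

variable [DecidableEq N] {P : N → Set (N → ℝ)}

/-- The objective in the dynamic programming equation is bounded below, uniformly over bounded sets
of feasible histories. -/
lemma step_bddBelow (hM : M.WellPosed) (hP : IsAmbiguityFamily tree P) {x₀ : M.Policy}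
    (h₀ : ∀ μ, x₀ μ ∈ M.feas μ x₀) (ν : N) : ∀ R : ℝ, ∃ C, ∀ x : M.Policy,
      M.FeasibleHistory ν x → ‖x‖ ≤ R → ∀ y ∈ M.feas ν x, C ≤ M.cost ν y +
        worstCase tree ν (P ν) fun c => M.Q P c (Function.update x ν y) := by
  induction ν using tree.backward_induction with | step ν ih => ?_
  intro R
  obtain ⟨R', hR'⟩ := feas_bounded hM (ν := ν) (x₀ := x₀) (fun s _ => h₀ _) R
  have hcc : Continuous (M.cost ν) := (cost_convexOn hM ν).locallyLipschitz.continuous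
  obtain ⟨K, hK⟩ := (isCompact_closedBall (0 : Fin (M.dim (tree.stage ν)) → ℝ)
    R').exists_bound_of_continuousOn hcc.continuousOn
  -- The radius grows to the maximum of R and R' because the child's history includes the new
  -- decision at ν.
  have hch : ∀ c, ∃ C, c ∈ tree.children ν → ∀ x : M.Policy, M.FeasibleHistory c x →
      ‖x‖ ≤ max R R' → C ≤ M.Q P c x := by
    intro c
    by_cases hc : c ∈ tree.children ν
    · obtain ⟨C, hC⟩ := ih c hc (max R R')
      refine ⟨C, fun _ x hx hxR => ?_⟩
      rw [Q_eq]
      refine le_csInf ((hM.feas_nonempty c x hx).image _) ?_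
      rintro _ ⟨y, hy, rfl⟩
      exact hC x hx hxR y hy
    · exact ⟨0, fun h => absurd h hc⟩
  choose C hC using hch
  refine ⟨-K + worstCase tree ν (P ν) C, fun x hx hxR y hy => add_le_add ?_ ?_⟩
  · exact (abs_le.1 (hK y (by simpa using hR' x hxR y hy))).1
  · refine worstCase_mono hP hP subset_rfl fun c hc => hC c hc _ (hx.update hM hc hy) ?_
    rw [pi_norm_le_iff_of_nonneg ((norm_nonneg x).trans (hxR.trans (le_max_left _ _)))]
    intro μ
    by_cases hμ : μ = ν
    · subst hμ
      rw [Function.update_self]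
      exact (hR' x hxR y hy).trans (le_max_right _ _)
    · rw [Function.update_of_ne hμ]
      exact (norm_le_pi_norm x μ).trans (hxR.trans (le_max_left _ _))

/-- Boundedness below is essential: a real infimum over an unbounded set defaults to zero and would
not be a lower bound. -/
lemma Q_le_step (hM : M.WellPosed) (hP : IsAmbiguityFamily tree P) {x : M.Policy}
    (hx : ∀ μ, x μ ∈ M.feas μ x) (ν : N) :
    M.Q P ν x ≤ M.cost ν (x ν) + worstCase tree ν (P ν) fun c => M.Q P c x := by
  obtain ⟨C, hC⟩ := step_bddBelow hM hP hx ν ‖x‖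
  rw [Q_eq]
  refine csInf_le ⟨C, ?_⟩ ⟨x ν, hx ν, by simp only [Function.update_eq_self]⟩
  rintro _ ⟨y, hy, rfl⟩
  exact hC x (fun s _ => hx _) le_rfl y hy

/-- The cost-to-go is a lower bound for the objective of feasible policies. -/
lemma Q_le_obj (hM : M.WellPosed) (hP : IsAmbiguityFamily tree P) {x : M.Policy}
    (hx : ∀ μ, x μ ∈ M.feas μ x) (ν : N) : M.Q P ν x ≤ M.obj P ν x := by
  induction ν using tree.backward_induction with | step ν ih => ?_
  rw [obj_eq]
  refine (Q_le_step hM hP hx ν).trans ?_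
  gcongr
  exact worstCase_mono hP hP subset_rfl ih

/-! ### Nearly optimal policies -/

/-- The policy is built forward, stage by stage, by approximate minimizers, so that neither
attainment nor semicontinuity of the cost-to-go is needed. Decisions at one stage are changed at all
its nodes at once; histories of nodes up to that stage are unaffected. -/
lemma exists_nearly_optimal_upto (hM : M.WellPosed) (P : N → Set (N → ℝ)) {x₀ : M.Policy}
    (h₀ : ∀ μ, x₀ μ ∈ M.feas μ x₀) (t : ℕ) {ε : ℝ} (hε : 0 < ε) (n : ℕ) :
    ∃ x : M.Policy, (∀ μ, tree.stage μ < t → x μ = x₀ μ) ∧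
      (∀ μ, tree.stage μ ≤ n → x μ ∈ M.feas μ x) ∧
      ∀ μ, t ≤ tree.stage μ → tree.stage μ ≤ n →
        M.cost μ (x μ) + worstCase tree μ (P μ) (fun c => M.Q P c x) ≤ M.Q P μ x + ε := by
  induction n with
  | zero =>
    exact ⟨x₀, fun _ _ => rfl, fun μ _ => h₀ μ, fun μ _ h =>
      absurd (tree.one_le_stage μ) (by omega)⟩
  | succ n ih =>
    obtain ⟨x, hx1, hx2, hx3⟩ := ih
    by_cases hn : n + 1 < t
    · refine ⟨x, hx1, fun μ hμ => ?_, fun μ h1 h2 => by omega⟩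
      rw [hx1 μ (by omega), feas_congr hM (SameHistory.of_stage fun μ' h => hx1 μ' (by omega))]
      exact h₀ μ
    have hy : ∀ μ, ∃ y, tree.stage μ = n + 1 → y ∈ M.feas μ x ∧ M.cost μ y +
        worstCase tree μ (P μ) (fun c => M.Q P c (Function.update x μ y)) < M.Q P μ x + ε := by
      intro μ
      by_cases hμ : tree.stage μ = n + 1
      · have hhist : M.FeasibleHistory μ x := fun s hs => by
          obtain ⟨h1, h2⟩ := Finset.mem_Ico.1 hs
          exact hx2 _ (by rw [tree.stage_proj h1 h2.le]; omega)
        obtain ⟨_, ⟨y, hy, rfl⟩, hlt⟩ := exists_lt_of_csInf_lt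
          ((hM.feas_nonempty μ x hhist).image _)
          (lt_of_eq_of_lt (Q_eq P μ x).symm (lt_add_of_pos_right (M.Q P μ x) hε))
        exact ⟨y, fun _ => ⟨hy, hlt⟩⟩
      · exact ⟨0, fun h => absurd h hμ⟩
    choose y hy using hy
    set x' : M.Policy := fun μ => if tree.stage μ = n + 1 then y μ else x μ with hx'
    have hne : ∀ μ, tree.stage μ ≠ n + 1 → x' μ = x μ := fun μ hμ => if_neg hμ
    have heq : ∀ μ, tree.stage μ = n + 1 → x' μ = y μ := fun μ hμ => if_pos hμ
    have hsame : ∀ μ, tree.stage μ ≤ n + 1 → SameHistory μ x' x := fun μ hμ =>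
      SameHistory.of_stage fun μ' h => hne μ' (by omega)
    refine ⟨x', fun μ hμ => by rw [hne μ (by omega), hx1 μ hμ], fun μ hμ => ?_, fun μ h1 h2 => ?_⟩
    · rw [feas_congr hM (hsame μ hμ)]
      rcases hμ.lt_or_eq with hlt | he
      · rw [hne μ hlt.ne]; exact hx2 μ (by omega)
      · rw [heq μ he]; exact (hy μ he).1
    · rw [Q_congr_history hM P μ (hsame μ h2)]
      rcases h2.lt_or_eq with hlt | he
      · rw [hne μ hlt.ne]
        refine le_of_eq_of_le ?_ (hx3 μ h1 (by omega))
        congr 1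
        exact worstCase_congr _ fun c hc => Q_congr_history hM P c
          (hsame c (by rw [tree.stage_of_mem_children hc]; omega))
      · rw [heq μ he]
        refine le_of_eq_of_le ?_ (hy μ he).2.le
        congr 1
        -- Changes at other nodes of the same stage are invisible to c, whose only ancestor of that
        -- stage is μ.
        refine worstCase_congr _ fun c hc => Q_congr_history hM P c ?_
        intro s hs
        rw [tree.stage_of_mem_children hc, Finset.mem_Ico] at hs
        rw [tree.proj_child hc (by omega)]
        rcases Nat.lt_succ_iff_lt_or_eq.1 hs.2 with hlt | rfl
        · have hst := tree.stage_proj hs.1 hlt.le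
          rw [Function.update_of_ne (fun h => by rw [h] at hst; omega), hne _ (by omega)]
        · rw [tree.proj_stage, Function.update_self, heq μ he]

/-- There are feasible policies with a given beginning that are nearly optimal at all later nodes. -/
lemma exists_obj_le_Q_add (hM : M.WellPosed) (hP : IsAmbiguityFamily tree P) {x₀ : M.Policy}
    (h₀ : ∀ μ, x₀ μ ∈ M.feas μ x₀) (u : N) {ε : ℝ} (hε : 0 < ε) :
    ∃ x : M.Policy, (∀ μ, tree.stage μ < tree.stage u → x μ = x₀ μ) ∧
      (∀ μ, x μ ∈ M.feas μ x) ∧ M.obj P u x ≤ M.Q P u x₀ + ε := by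
  -- Each stage from that of ν to T contributes one error δ, which gives T + 1 minus the stage of ν
  -- such errors.
  set δ := ε / (T + 1) with hδ
  have hδ0 : 0 < δ := by positivity
  obtain ⟨x, hx1, hx2, hx3⟩ := exists_nearly_optimal_upto hM P h₀ (tree.stage u) hδ0 T
  refine ⟨x, hx1, fun μ => hx2 μ (tree.stage_le μ), ?_⟩
  have key : ∀ ν, tree.stage u ≤ tree.stage ν →
      M.obj P ν x ≤ M.Q P ν x + (T + 1 - tree.stage ν) * δ := by
    intro ν
    induction ν using tree.backward_induction with | step ν ih => ?_
    intro hν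
    have hT : (tree.stage ν : ℝ) ≤ T := by exact_mod_cast tree.stage_le ν
    have hw := worstCase_le_add (ν := ν) (V := fun c => M.obj P c x) (V' := fun c => M.Q P c x)
      (a := (T - tree.stage ν) * δ) hP hP subset_rfl
      (mul_nonneg (sub_nonneg.2 hT) hδ0.le) fun c hc => by
        have hs := tree.stage_of_mem_children hc
        have := ih c hc (by omega)
        rw [hs] at this
        push_cast at this
        linarith
    rw [obj_eq]
    linarith [hx3 ν hν (tree.stage_le ν)]
  have h1 := key u le_rfl
  rw [Q_congr_history hM P u (SameHistory.of_stage hx1)] at h1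
  have h2 : ((T : ℝ) + 1 - tree.stage u) * δ ≤ ε := by
    rw [hδ, ← mul_div_assoc, div_le_iff₀ (by positivity), mul_comm]
    have : (0 : ℝ) ≤ tree.stage u := by positivity
    gcongr
    linarith
  linarith

/-! ### From local agreement of objectives to cost-to-go functions -/

/-- If the objectives for two families of ambiguity sets agree near a policy that is optimal for
the larger family, then the cost-to-go functions compare along this policy. -/
lemma Q_le_Q_of_eventually_eq {P' : N → Set (N → ℝ)} (hM : M.WellPosed)
    (hP : IsAmbiguityFamily tree P) (hP' : IsAmbiguityFamily tree P') {x : M.Policy}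
    (hx : M.IsOptimalPolicy P x) {u : N} (h : ∀ᶠ x' in nhds x, M.obj P' u x' = M.obj P u x') :
    M.Q P u x ≤ M.Q P' u x := by
  have hfeas := fun μ => (hx μ).1
  set K : Set M.Policy := {x' | (∀ μ, tree.stage μ < tree.stage u → x' μ = x μ) ∧
    ∀ μ, x' μ ∈ M.feas μ x'} with hK
  have hKconv : Convex ℝ K := by
    rintro y ⟨hy1, hy2⟩ z ⟨hz1, hz2⟩ a b ha hb hab
    refine ⟨fun μ hμ => ?_, fun μ => feas_convex hM (hy2 μ) (hz2 μ) ha hb hab⟩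
    rw [Pi.add_apply, Pi.smul_apply, Pi.smul_apply, hy1 μ hμ, hz1 μ hμ, ← add_smul, hab, one_smul]
  -- Near x the new objective equals the old one, which is bounded below by the old cost-to-go. That
  -- depends only on the history shared by all of K, and x attains it.
  have hloc : IsLocalMinOn (M.obj P' u) K x := by
    filter_upwards [h.filter_mono nhdsWithin_le_nhds, self_mem_nhdsWithin] with x' he hmem
    rw [he, h.self_of_nhds, hx.obj_eq_Q,
      ← Q_congr_history hM P u (SameHistory.of_stage hmem.1)]
    exact Q_le_obj hM hP hmem.2 u
  have hmin := IsMinOn.of_isLocalMinOn_of_convexOn (show x ∈ K from ⟨fun _ _ => rfl, hfeas⟩) hloc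
    ((obj_convexOn hM hP' u).subset (Set.subset_univ _) hKconv)
  refine le_of_forall_pos_le_add fun ε hε => ?_
  obtain ⟨x', h1, h2, h3⟩ := exists_obj_le_Q_add hM hP' hfeas u hε
  rw [← hx.obj_eq_Q, ← h.self_of_nhds]
  exact (hmin ⟨h1, h2⟩).trans h3

end Program


/-! ### Effectiveness along a path -/

open Program

variable {T : ℕ} {N : Type*} {tree : ScenarioTree T N} {M : Program tree} [Fintype N]
  [DecidableEq N] {q γ : N → ℝ} {x : M.Policy}

/-- The tests use values that include the current cost; by total mass one this shift leaves the
worst-case distributions unchanged. -/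
lemma IsWorstCase.const_add {P : N → Set (N → ℝ)} (hP : IsAmbiguityFamily tree P) {ν : N}
    {V p : N → ℝ} (hp : IsWorstCase tree ν (P ν) V p) (k : ℝ) :
    IsWorstCase tree ν (P ν) (fun c => k + V c) p := by
  have hsum : ∀ p' ∈ P ν, ∑ c ∈ tree.children ν, p' c * (k + V c)
      = k + ∑ c ∈ tree.children ν, p' c * V c := fun p' hp' => by
    simp_rw [mul_add]
    rw [Finset.sum_add_distrib, ← Finset.sum_mul, hP.sum_eq_one ν p' hp', one_mul]
  refine ⟨hp.1, fun p' hp' => ?_⟩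
  rw [hsum p' hp', hsum p hp.1]
  linarith [hp.2 p' hp']

lemma childValue_eq (hx : M.IsOptimalPolicy (tvBall tree q γ) x) (ν : N) :
    childValue M q γ x ν = fun c => M.cost ν (x ν) + M.obj (tvBall tree q γ) c x :=
  funext fun c => by rw [childValue, hx.obj_eq_Q]

/-- If all nodes on the path from `u` to `c₀` are identifiably conditionally effective along an
optimal policy, then removing `c₀` decreases the objective of this policy at `u`. -/
lemma obj_removeNodes_lt (hq0 : ∀ c, 0 ≤ q c)
    (hq : ∀ ν, tree.stage ν < T → ∑ c ∈ tree.children ν, q c = 1) (hγ : ∀ ν, 0 ≤ γ ν ∧ γ ν ≤ 1)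
    (hx : M.IsOptimalPolicy (tvBall tree q γ) x) {c₀ : N}
    (hne : (removeNodes tree (tvBall tree q γ) {c₀} (tree.parent c₀)).Nonempty) (n : ℕ)
    (hn : n + 1 < tree.stage c₀)
    (heff : ∀ i ≤ n, IdentifiablyCondEffective M q γ x (tree.parent^[i] c₀)) :
    M.obj (removeNodes tree (tvBall tree q γ) {c₀}) (tree.parent^[n + 1] c₀) x <
      M.obj (tvBall tree q γ) (tree.parent^[n + 1] c₀) x := by
  induction n using Nat.strong_induction_on with | _ n ih => ?_
  have hP := IsAmbiguityFamily.tvBall hq0 hq fun ν => (hγ ν).1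
  have hP' := hP.removeNodes hne
  have hstrict : n = 0 ∨ M.obj (removeNodes tree (tvBall tree q γ) {c₀}) (tree.parent^[n] c₀) x <
      M.obj (tvBall tree q γ) (tree.parent^[n] c₀) x := by
    rcases n with _ | n
    · exact Or.inl rfl
    · exact Or.inr <| ih n n.lt_succ_self (by omega) fun i hi => heff i (by omega)
  have hc := tree.mem_children_iterate hn
  have hpar : tree.parent (tree.parent^[n] c₀) = tree.parent^[n + 1] c₀ :=
    (Function.iterate_succ_apply' _ _ _).symm
  have htest := heff n le_rfl
  rw [IdentifiablyCondEffective, hpar, childValue_eq hx] at htest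
  set ν := tree.parent^[n + 1] c₀ with hν
  set c := tree.parent^[n] c₀ with hcdef
  have hνT : tree.stage ν < T := by
    have := tree.stage_of_mem_children hc
    have := tree.stage_le c
    omega
  rw [obj_eq, obj_eq]
  refine add_lt_add_right ?_ _
  obtain ⟨p, hp, he⟩ := exists_isWorstCase hP' hνT
    fun c => M.obj (removeNodes tree (tvBall tree q γ) {c₀}) c x
  have hle : ∀ d ∈ tree.children ν, p d * M.obj (removeNodes tree (tvBall tree q γ) {c₀}) d x ≤
      p d * M.obj (tvBall tree q γ) d x := fun d hd => mul_le_mul_of_nonneg_left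
    (obj_mono hP' hP (removeNodes_subset _ _) x d) (hP'.nonneg ν p hp.1 d hd)
  rw [← he]
  -- If p is also worst-case in the original problem, the test gives c positive mass. For n = 0 this
  -- contradicts the removal of c₀, and otherwise the strict drop at c carries over. If it is not,
  -- some original distribution is strictly better than p.
  by_cases hw : IsWorstCase tree ν (tvBall tree q γ ν) (fun c => M.obj (tvBall tree q γ) c x) p
  · have hpos : 0 < p c := (hw.const_add hP (M.cost ν (x ν))).pos hq0 (hq ν hνT) (hγ ν).2 htest
    refine lt_of_lt_of_le (Finset.sum_lt_sum hle ⟨c, hc, ?_⟩) (le_worstCase hP hw.1)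
    rcases hstrict with h0 | hlt
    · have hcc : c = c₀ := by rw [hcdef, h0]; rfl
      exact absurd (hp.1.2 c hc hcc) hpos.ne'
    · exact mul_lt_mul_of_pos_left hlt hpos
  · have : ∃ p' ∈ tvBall tree q γ ν, ∑ c ∈ tree.children ν, p c * M.obj (tvBall tree q γ) c x <
        ∑ c ∈ tree.children ν, p' c * M.obj (tvBall tree q γ) c x := by
      by_contra! hcon
      exact hw ⟨hp.1.1, hcon⟩
    obtain ⟨p', hp', hlt⟩ := this
    exact (Finset.sum_le_sum hle).trans_lt (hlt.trans_le (le_worstCase hP hp'))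

/-- If some node on the path from `u` to `c₀` is identifiably conditionally ineffective along an
optimal policy, then removing `c₀` does not change the objective at `u` of policies near the optimal
one. -/
lemma eventually_obj_removeNodes_eq (hM : M.WellPosed) (hq0 : ∀ c, 0 ≤ q c)
    (hq : ∀ ν, tree.stage ν < T → ∑ c ∈ tree.children ν, q c = 1) (hγ : ∀ ν, 0 ≤ γ ν ∧ γ ν ≤ 1)
    (hx : M.IsOptimalPolicy (tvBall tree q γ) x) {c₀ : N}
    (hne : (removeNodes tree (tvBall tree q γ) {c₀} (tree.parent c₀)).Nonempty) (n : ℕ)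
    (hn : n + 1 < tree.stage c₀)
    (hineff : ∃ i ≤ n, IdentifiablyCondIneffective M q γ x (tree.parent^[i] c₀)) :
    ∀ᶠ x' in nhds x,
      M.obj (removeNodes tree (tvBall tree q γ) {c₀}) (tree.parent^[n + 1] c₀) x' =
        M.obj (tvBall tree q γ) (tree.parent^[n + 1] c₀) x' := by
  induction n using Nat.strong_induction_on with | _ n ih => ?_
  have hP := IsAmbiguityFamily.tvBall hq0 hq fun ν => (hγ ν).1
  have hP' := hP.removeNodes hne
  have hsib : ∀ d ∈ tree.children (tree.parent^[n + 1] c₀), (n = 0 ∨ d ≠ tree.parent^[n] c₀) →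
      ∀ x', M.obj (removeNodes tree (tvBall tree q γ) {c₀}) d x' =
        M.obj (tvBall tree q γ) d x' := fun d hd hd' =>
    obj_removeNodes_eq _ d (tree.iterate_parent_ne_sibling hn hd hd')
  have hc := tree.mem_children_iterate hn
  have hpar : tree.parent (tree.parent^[n] c₀) = tree.parent^[n + 1] c₀ :=
    (Function.iterate_succ_apply' _ _ _).symm
  have hset : n ≠ 0 → removeNodes tree (tvBall tree q γ) {c₀} (tree.parent^[n + 1] c₀) =
      tvBall tree q γ (tree.parent^[n + 1] c₀) := by
    intro h0
    refine removeNodes_eq_self _ fun hmem => ?_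
    have h1 := tree.stage_of_mem_children hmem
    have h2 := tree.stage_iterate_parent (n + 1) c₀
    omega
  obtain ⟨i, hi, htest⟩ := hineff
  rcases hi.lt_or_eq with hlt | rfl
  -- The ineffective node lies further down, so agreement near x is inherited: siblings off the path
  -- are unaffected and the ambiguity set at this node is intact.
  · obtain ⟨m, rfl⟩ : ∃ m, n = m + 1 := ⟨n - 1, by omega⟩
    filter_upwards [ih m m.lt_succ_self (by omega) ⟨i, by omega, htest⟩] with x' hx'
    rw [obj_eq, obj_eq, hset (by omega)]
    congr 1
    refine worstCase_congr _ fun d hd => ?_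
    by_cases hd' : d = tree.parent^[m + 1] c₀
    · rw [hd', hx']
    · exact hsib d hd (Or.inr hd') x'
  · rw [IdentifiablyCondIneffective, hpar, childValue_eq hx] at htest
    set ν := tree.parent^[i + 1] c₀ with hν
    set c := tree.parent^[i] c₀ with hcdef
    have hνT : tree.stage ν < T := by
      have := tree.stage_of_mem_children hc
      have := tree.stage_le c
      omega
    -- The current cost stays frozen at x although x' varies; as a common constant it does not
    -- influence worst-case distributions.
    have hdom := (htest.isDominated (hq ν hνT) (hγ ν).2).eventually hq0
      (l := nhds x) (H := fun x' c => M.cost ν (x ν) + M.obj (tvBall tree q γ) c x') fun d =>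
        (continuous_const.add (obj_continuous hM hP d)).tendsto x
    filter_upwards [hdom] with x' hd
    refine le_antisymm (obj_mono hP' hP (removeNodes_subset _ _) x' ν) ?_
    rw [obj_eq, obj_eq]
    refine add_le_add_right ?_ _
    obtain ⟨p, hp, he⟩ := exists_isWorstCase hP hνT fun c => M.obj (tvBall tree q γ) c x'
    have hpc : p c = 0 := (hp.const_add hP (M.cost ν (x ν))).eq_zero hq0 (hq ν hνT) hc hd
    -- Since p ignores c, it stays admissible after the removal, and the only child whose objective
    -- may have changed has weight zero.
    have hmem : p ∈ removeNodes tree (tvBall tree q γ) {c₀} ν := by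
      by_cases h0 : i = 0
      · refine ⟨hp.1, ?_⟩
        rintro d - rfl
        rw [← hpc, hcdef, h0]; rfl
      · rw [hset h0]; exact hp.1
    rw [← he]
    refine le_of_eq_of_le (Finset.sum_congr rfl fun d hd => ?_) (le_worstCase hP' hmem)
    by_cases hdc : d = c
    · rw [hdc, hpc, zero_mul, zero_mul]
    · rw [hsib d hd (Or.inr hdc)]

/-- An identifiably conditionally ineffective node can be removed without emptying the ambiguity
set of its parent. -/
lemma IdentifiablyCondIneffective.removeNodes_nonempty (hq0 : ∀ c, 0 ≤ q c)
    (hq : ∀ ν, tree.stage ν < T → ∑ c ∈ tree.children ν, q c = 1) (hγ : ∀ ν, 0 ≤ γ ν ∧ γ ν ≤ 1)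
    {c : N} (h : IdentifiablyCondIneffective M q γ x c) :
    (removeNodes tree (tvBall tree q γ) {c} (tree.parent c)).Nonempty := by
  have hc := h.1
  have hνT : tree.stage (tree.parent c) < T := by
    have := tree.stage_of_mem_children hc
    have := tree.stage_le c
    omega
  obtain ⟨p, hp, -⟩ := exists_isWorstCase (IsAmbiguityFamily.tvBall hq0 hq fun ν => (hγ ν).1) hνT
    (childValue M q γ x (tree.parent c))
  refine ⟨p, hp.1, ?_⟩
  rintro d - rfl
  exact hp.eq_zero hq0 (hq _ hνT) hc (h.isDominated (hq _ hνT) (hγ _).2)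

/-! ### Assessment problems and comparison of optimal values -/

/-- The conditional assessment problem as the cost-to-go function of an assessment problem. -/
lemma condAssessment_eq_Q (P : N → Set (N → ℝ)) {c : N} (hc : 1 < tree.stage c) (y : M.Policy) :
    condAssessment M P {c} (tree.parent c) y = M.Q (removeNodes tree P {c}) (tree.parent c) y := by
  rw [condAssessment, Q_eq]
  congr 2
  funext z
  congr 1
  exact worstCase_congr _ fun d hd => (Q_removeNodes_eq P d
    (tree.iterate_parent_ne_sibling (n := 0) (by omega) hd (Or.inl rfl)) _).symm

/-- The history at the root is vacuous, so the zero policy may be replaced by the optimal one. -/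
lemma optimalValue_eq_Q (hM : M.WellPosed) (P : N → Set (N → ℝ)) (y : M.Policy) :
    M.optimalValue P = M.Q P tree.root y :=
  Q_congr_history hM P _ (SameHistory.of_stage fun μ hμ => by
    have := tree.one_le_stage μ
    rw [tree.stage_root] at hμ
    omega)

/-- A path all of whose nodes are identifiably conditionally effective: the cost-to-go of the
assessment problem is smaller. -/
lemma Q_removeNodes_lt (hM : M.WellPosed) (hq0 : ∀ c, 0 ≤ q c)
    (hq : ∀ ν, tree.stage ν < T → ∑ c ∈ tree.children ν, q c = 1) (hγ : ∀ ν, 0 ≤ γ ν ∧ γ ν ≤ 1)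
    (hx : M.IsOptimalPolicy (tvBall tree q γ) x) {c₀ : N}
    (hne : (removeNodes tree (tvBall tree q γ) {c₀} (tree.parent c₀)).Nonempty) (n : ℕ)
    (hn : n + 1 < tree.stage c₀)
    (heff : ∀ i ≤ n, IdentifiablyCondEffective M q γ x (tree.parent^[i] c₀)) :
    M.Q (removeNodes tree (tvBall tree q γ) {c₀}) (tree.parent^[n + 1] c₀) x <
      M.Q (tvBall tree q γ) (tree.parent^[n + 1] c₀) x := by
  have hP := IsAmbiguityFamily.tvBall hq0 hq fun ν => (hγ ν).1
  rw [← hx.obj_eq_Q]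
  exact (Q_le_obj hM (hP.removeNodes hne) (fun μ => (hx μ).1) _).trans_lt
    (obj_removeNodes_lt hq0 hq hγ hx hne n hn heff)

/-- A path with an identifiably conditionally ineffective node: the cost-to-go of the assessment
problem is not smaller. -/
lemma Q_le_Q_removeNodes (hM : M.WellPosed) (hq0 : ∀ c, 0 ≤ q c)
    (hq : ∀ ν, tree.stage ν < T → ∑ c ∈ tree.children ν, q c = 1) (hγ : ∀ ν, 0 ≤ γ ν ∧ γ ν ≤ 1)
    (hx : M.IsOptimalPolicy (tvBall tree q γ) x) {c₀ : N}
    (hne : (removeNodes tree (tvBall tree q γ) {c₀} (tree.parent c₀)).Nonempty) (n : ℕ)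
    (hn : n + 1 < tree.stage c₀)
    (hineff : ∃ i ≤ n, IdentifiablyCondIneffective M q γ x (tree.parent^[i] c₀)) :
    M.Q (tvBall tree q γ) (tree.parent^[n + 1] c₀) x ≤
      M.Q (removeNodes tree (tvBall tree q γ) {c₀}) (tree.parent^[n + 1] c₀) x := by
  have hP := IsAmbiguityFamily.tvBall hq0 hq fun ν => (hγ ν).1
  exact Q_le_Q_of_eventually_eq hM hP (hP.removeNodes hne) hx
    (eventually_obj_removeNodes_eq hM hq0 hq hγ hx hne n hn hineff)

lemma AssessmentWellDefined.removeNodes_nonempty {P : N → Set (N → ℝ)} {ω : N}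
    (hω : tree.stage ω = T) (hT : 1 < T) (h : AssessmentWellDefined tree P {ω}) :
    (removeNodes tree P {ω} (tree.parent ω)).Nonempty :=
  h _ (by rw [tree.stage_parent_eq]; omega)

end MultistageDRO

/-! ### The main theorem -/

open MultistageDRO in
theorem mainTheorem1 {T : ℕ} (hT : 1 < T) {N : Type*} [Fintype N] [DecidableEq N]
    (tree : MultistageDRO.ScenarioTree T N)
    (M : MultistageDRO.Program tree) (hM : M.WellPosed)
    -- `q c` is the nominal conditional probability of `c` given its parent
    (q : N → ℝ) (hq_nonneg : ∀ c, 0 ≤ q c)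
    (hq_sum : ∀ ν, tree.stage ν < T → ∑ c ∈ tree.children ν, q c = 1)
    -- `γ ν` is the level of robustness of the conditional ambiguity set at `ν`
    (γ : N → ℝ) (hγ : ∀ ν, 0 ≤ γ ν ∧ γ ν ≤ 1)
    (x : M.Policy) (hx : M.IsOptimalPolicy (MultistageDRO.tvBall tree q γ) x)
    (ω : N) (hω : tree.stage ω = T) :
    -- identification is sound along the path
    (∀ t ∈ Finset.Icc 2 T,
      (MultistageDRO.IdentifiablyCondEffective M q γ x (tree.proj t ω) →
        MultistageDRO.CondEffective M (MultistageDRO.tvBall tree q γ) x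
          {tree.proj t ω} (tree.proj (t - 1) ω)) ∧
      (MultistageDRO.IdentifiablyCondIneffective M q γ x (tree.proj t ω) →
        ¬ MultistageDRO.CondEffective M (MultistageDRO.tvBall tree q γ) x
          {tree.proj t ω} (tree.proj (t - 1) ω))) ∧
    -- all realizations identifiably conditionally effective: the path is effective
    ((∀ t ∈ Finset.Icc 2 T,
        MultistageDRO.IdentifiablyCondEffective M q γ x (tree.proj t ω)) →
      MultistageDRO.EffectivePaths M (MultistageDRO.tvBall tree q γ) {ω}) ∧
    -- some realization identifiably conditionally ineffective: the path is ineffective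
    (MultistageDRO.AssessmentWellDefined tree (MultistageDRO.tvBall tree q γ) {ω} →
      (∃ t ∈ Finset.Icc 2 T,
        MultistageDRO.IdentifiablyCondIneffective M q γ x (tree.proj t ω)) →
      ¬ MultistageDRO.EffectivePaths M (MultistageDRO.tvBall tree q γ) {ω}) ∧
    -- the resulting equivalence when every realization along the path is identified
    (MultistageDRO.AssessmentWellDefined tree (MultistageDRO.tvBall tree q γ) {ω} →
      (∀ t ∈ Finset.Icc 2 T,
        MultistageDRO.IdentifiablyCondEffective M q γ x (tree.proj t ω) ∨
        MultistageDRO.IdentifiablyCondIneffective M q γ x (tree.proj t ω)) →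
      (MultistageDRO.EffectivePaths M (MultistageDRO.tvBall tree q γ) {ω} ↔
        ∀ t ∈ Finset.Icc 2 T,
          MultistageDRO.IdentifiablyCondEffective M q γ x (tree.proj t ω))) := by
  -- The root is T - 1 steps above the leaf; this form matches n = T - 2 in the comparison lemmas.
  have hroot : tree.parent^[T - 2 + 1] ω = tree.root := by
    refine tree.eq_root_of_stage_eq_one ?_
    rw [tree.stage_iterate_parent]
    omega
  have hproj : ∀ t, tree.proj t ω = tree.parent^[T - t] ω := fun t => by
    rw [ScenarioTree.proj, hω]
  have heffective : (∀ t ∈ Finset.Icc 2 T, IdentifiablyCondEffective M q γ x (tree.proj t ω)) →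
      EffectivePaths M (tvBall tree q γ) {ω} := by
    intro h
    by_cases hne : (removeNodes tree (tvBall tree q γ) {ω} (tree.parent ω)).Nonempty
    · refine Or.inr ?_
      rw [optimalValue_eq_Q hM _ x, optimalValue_eq_Q hM _ x, ← hroot]
      refine Q_removeNodes_lt hM hq_nonneg hq_sum hγ hx hne (T - 2) (by omega) fun i hi => ?_
      have := h (T - i) (Finset.mem_Icc.2 (by omega))
      rwa [hproj, show T - (T - i) = i by omega] at this
    · exact Or.inl fun hwd => hne (hwd.removeNodes_nonempty hω hT)
  have hineffective : AssessmentWellDefined tree (tvBall tree q γ) {ω} →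
      (∃ t ∈ Finset.Icc 2 T, IdentifiablyCondIneffective M q γ x (tree.proj t ω)) →
      ¬ EffectivePaths M (tvBall tree q γ) {ω} := by
    rintro hwd ⟨t, ht, h⟩ (hnot | hlt)
    · exact hnot hwd
    · rw [optimalValue_eq_Q hM _ x, optimalValue_eq_Q hM _ x, ← hroot] at hlt
      refine not_le.2 hlt (Q_le_Q_removeNodes hM hq_nonneg hq_sum hγ hx
        (hwd.removeNodes_nonempty hω hT) (T - 2) (by omega) ⟨T - t, ?_, hproj t ▸ h⟩)
      have := Finset.mem_Icc.1 ht
      omega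
  refine ⟨fun t ht => ?_, heffective, hineffective, fun hwd hid => ⟨fun h t ht => ?_, heffective⟩⟩
  · obtain ⟨h2, hT'⟩ := Finset.mem_Icc.1 ht
    have hstage : tree.stage (tree.proj t ω) = t := tree.stage_proj (by omega) (by omega)
    rw [tree.proj_pred (s := t) (by omega) (by omega)]
    refine ⟨fun h => ?_, fun h => ?_⟩
    · by_cases hne : (removeNodes tree (tvBall tree q γ) {tree.proj t ω}
        (tree.parent (tree.proj t ω))).Nonempty
      · refine Or.inr ?_
        rw [condAssessment_eq_Q _ (by omega)]
        -- Here the removed node is the stage-t node itself, in general not a leaf, and the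
        -- comparison takes place at its parent.
        refine Q_removeNodes_lt hM hq_nonneg hq_sum hγ hx hne 0 (by omega) fun i hi => ?_
        rw [Nat.le_zero.1 hi]
        exact h
      · exact Or.inl (Set.not_nonempty_iff_eq_empty.1 hne)
    · have hne := h.removeNodes_nonempty hq_nonneg hq_sum hγ
      rintro (hem | hlt)
      · exact hne.ne_empty hem
      · rw [condAssessment_eq_Q _ (by omega)] at hlt
        exact not_le.2 hlt (Q_le_Q_removeNodes hM hq_nonneg hq_sum hγ hx hne 0 (by omega)
          ⟨0, le_rfl, h⟩)
  · exact (hid t ht).resolve_right fun hi => hineffective hwd ⟨t, ht, hi⟩ h
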